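/- Let $\mathfrak g$ be a complex semisimple Lie algebra with Cartan subalgebra $\mathfrak h$, root system $R$ and a chosen base of $R$, and let $V$ be a faithful finite-dimensional irreducible $\mathfrak g$-module of highest weight $\chi$. Let $L_V^*=\{h\in\mathfrak h:\mu(h)\in\mathbb Z \text{ for all weights }\mu\text{ of }V\}$ and $(L_V^*)_+=\{h\in L_V^*:\alpha(h)\ge 0\text{ for all }\alpha\in R^+\}$. For a field $F$ with $\mathbb C\subseteq F\subseteq\mathbb C((z))$ let $G(F)$ be the Chevalley group of $(\mathfrak g,V)$ over $F$, i.e. the group of automorphisms generated by the $\exp(tX_\alpha)$ ($X_\alpha$ a root vector, $t\in F$) and the torus elements $t^h$ ($t\in F^\times$, $h\in L_V^*$), where $t^h$ multiplies vectors of weight $\mu$ by $t^{\mu(h)}$. Let $K=G(\mathbb C[[z]])$ be the subgroup of $G(\mathbb C((z)))$ preserving $V[[z]]$. For $h\in L_V^*$ put $V_i=\{v\in V: hv=-iv\}$, $F_j^h=\bigoplus_{s\le j}V_s$ and $\mathcal F_h=\{\sum_j f_jz^j\in V((z)): f_j\in F^h_j\ \forall j\}$. Let $\Sigma$ be a Riemann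 surface with a holomorphic local coordinate $z$ fixed at each of its points, $\Gamma\subset\Sigma$ a finite set and $h=(h_\gamma)_{\gamma\in\Gamma}$ with $h_\gamma\in(L_V^*)_+$. A distribution with support $\Gamma$ assigns to every $x\in\Sigma$ a germ $\Psi_x$ of a meromorphic $G$-valued function (an element of $G$ over the field of convergent Laurent series in $z$), holomorphic for $x\notin\Gamma$; a matrix divisor is a class of distributions modulo left multiplication by everywhere holomorphic distributions. It has toric invariants $h$ if, for every $\gamma\in\Gamma$, $\Psi_\gamma=kz^{h_\gamma}k'$ with $k,k'$ germs of holomorphic $G$-valued functions. Its sections over an open $U\subseteq\Sigma$ are the meromorphic $V$-valued functions $f$ on $U$, holomorphic on $U\setminus\Gamma$, such that $\Psi_\gamma f$ is holomorphic near each $\gamma\in U\cap\Gamma$. Let $\mathcal M^{\chi,\Gamma}_h$ be the set of matrix divisors with invariants $h$, where two of them are identified if they have the same sheaf of sections. For $\gamma\in\Gamma$ let $G_\gamma=\{g\in G(\mathbb C((z))): g\mathcal F_{h_\gamma}=\mathcal F_{h_\gamma}\}$ be the stabilizer of the flag determined by $h_\gamma$, let $K_\gamma=K\cap G_\gamma$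 and $K_0=\prod_{\gamma\in\Gamma}K_\gamma$. Then $\mathcal M^{\chi,\Gamma}_h$ is the homogeneous space $$\mathcal M^{\chi,\Gamma}_h\;\cong\;\underbrace{K\times\dots\times K}_{|\Gamma|\text{ times}}/K_0 .$$ More precisely: (1) $K^{\Gamma}$ acts on $\mathcal M^{\chi,\Gamma}_h$ by $(k,\Psi)\mapsto\Psi k^{-1}$, i.e. $k\cdot[\Psi]=[\Psi']$ if and only if $\Psi'_\gamma k_\gamma\Psi_\gamma^{-1}\in K$ for all $\gamma\in\Gamma$. (2) There is a $K^\Gamma$-equivariant bijection $e:K^\Gamma/K_0\to\mathcal M^{\chi,\Gamma}_h$ such that the sections over $U$ of $e(kK_0)$ are the meromorphic $V$-valued functions on $U$, holomorphic on $U\setminus\Gamma$, whose Laurent expansion at each $\gamma\in U\cap\Gamma$ lies in $k_\gamma\mathcal F_{h_\gamma}$. (3) For $g\in G(\mathbb C)$, the sheaf of sections of $m'\in\mathcal M^{\chi,\Gamma}_h$ is the shift $f\mapsto gf$ of that of $m$ if and only if $m'=(g,\dots,g)\cdot m$. Hence the classes of matrix divisors up to a common left shift of the sheaf of sections by a constant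 element of $G$ are the orbits of the diagonal $G(\mathbb C)\subset K^\Gamma$ on $K^\Gamma/K_0$. -/

import Mathlib

open scoped Manifold ContDiff TensorProduct Topology Pointwise LaurentSeries

noncomputable section

namespace MatrixDivisors

/-! ### Laurent series with coefficients in a vector space -/

section Laurent

/-- The `ℂ`-algebra structure on `ℂ((z))` with coefficientwise scalar multiplication (declared here
so that it is preferred to the one that Mathlib derives from the power series ring). -/
instance laurentAlgebra : Algebra ℂ ℂ⸨X⸩ := HahnSeries.instAlgebra

variable (V : Type*) [AddCommGroup V] [Module ℂ V]

/-- For a finite dimensional `V` this is the space `V((z))` of formal Laurent series in `z` with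
coefficients in `V`, viewed as a vector space over the field `ℂ((z))`. -/
abbrev LaurentModule : Type _ := ℂ⸨X⸩ ⊗[ℂ] V

/-- The group `GL(V((z)))` of `ℂ((z))`-linear automorphisms. -/
abbrev LoopGL : Type _ := LinearMap.GeneralLinearGroup ℂ⸨X⸩ (LaurentModule V)

variable {V}

/-- The coefficient `s_n ∈ V` of `s = ∑ s_n z^n ∈ V((z))`. -/
def vcoeff (n : ℤ) : LaurentModule V →ₗ[ℂ] V :=
  (TensorProduct.lid ℂ V).toLinearMap ∘ₗ
    LinearMap.rTensor V (HahnSeries.coeff.linearMap (R := ℂ) (V := ℂ) n)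

/-- The formal Laurent series with a positive radius of convergence, i.e. the expansions of germs
of meromorphic functions. -/
def convergent : Set ℂ⸨X⸩ :=
  {a | ∃ r : ℝ, 0 < r ∧ Summable fun n : ℕ => ‖a.coeff (n : ℤ)‖ * r ^ n}

/-- The series `z ∈ ℂ((z))`. -/
def zSeries : ℂ⸨X⸩ := HahnSeries.single 1 1

variable (V) in
/-- The lattice `V[[z]]` in `V((z))`. -/
def taylorLattice : Submodule ℂ (LaurentModule V) where
  carrier := {s | ∀ n : ℤ, n < 0 → vcoeff n s = 0}
  add_mem' ha hb n hn := by rw [map_add, ha n hn, hb n hn, add_zero]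
  zero_mem' n _ := map_zero _
  smul_mem' c x hx n hn := by rw [map_smul, hx n hn, smul_zero]

end Laurent

/-! ### The Chevalley group -/

section Chevalley

variable {𝔤 : Type*} [LieRing 𝔤] [LieAlgebra ℂ 𝔤] [FiniteDimensional ℂ 𝔤]
  [LieAlgebra.IsSemisimple ℂ 𝔤]
  (H : LieSubalgebra ℂ 𝔤) [H.IsCartanSubalgebra]
  (V : Type*) [AddCommGroup V] [Module ℂ V] [LieRingModule 𝔤 V] [LieModule ℂ 𝔤 V]
  [FiniteDimensional ℂ V]

/-- `exp (t x) = ∑ t^n x^n / n!` as an endomorphism of `V((z))`, for an element `x` of `𝔤` that acts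
nilpotently on `V` (the sum is finite). -/
def expEnd (x : 𝔤) (t : ℂ⸨X⸩) : Module.End ℂ⸨X⸩ (LaurentModule V) :=
  ∑ n ∈ Finset.range (nilpotencyClass (LieModule.toEnd ℂ 𝔤 V x)),
    (algebraMap ℂ ℂ⸨X⸩ ((n.factorial : ℂ)⁻¹) * t ^ n) •
      LinearMap.baseChange ℂ⸨X⸩ ((LieModule.toEnd ℂ 𝔤 V x) ^ n)

/-- The lattice `L_V^*`: the elements of the Cartan subalgebra on which all weights of `V` take
integer values. -/
def dualWeightLattice : Set H :=
  {h | ∀ μ : LieModule.Weight ℂ H V, ∃ n : ℤ, μ h = (n : ℂ)}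

/-- `u = t^h`: the automorphism `u` of `V((z))` multiplies every vector of weight `μ` by
`t ^ μ(h)`. As `V` is spanned by weight vectors, this determines `u`. -/
def IsTorusElement (h : H) (t : ℂ⸨X⸩) (u : LoopGL V) : Prop :=
  ∀ (μ : LieModule.Weight ℂ H V) (n : ℤ), μ h = (n : ℂ) →
    ∀ v ∈ LieModule.weightSpace V (μ : H → ℂ),
      (u : Module.End ℂ⸨X⸩ (LaurentModule V)) (1 ⊗ₜ[ℂ] v) = (t ^ n) ⊗ₜ[ℂ] v

/-- The subgroup of `GL(V((z)))` generated by the root elements `exp (t x)`, `x` a root vector, and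
the elements `t^h`, `t ≠ 0`, `h ∈ L_V^*`, of the maximal torus, with all parameters `t` in `T`. For
`T` a subfield of `ℂ((z))` this is the Chevalley group of `(𝔤, V)` over `T`. -/
def chevalley (T : Set ℂ⸨X⸩) : Subgroup (LoopGL V) :=
  Subgroup.closure
    ({u | ∃ α ∈ H.root, ∃ x ∈ LieAlgebra.rootSpace H α, ∃ t ∈ T,
        (u : Module.End ℂ⸨X⸩ (LaurentModule V)) = expEnd V x t} ∪
     {u | ∃ h ∈ dualWeightLattice H V, ∃ t ∈ T, t ≠ 0 ∧ IsTorusElement H V h t u})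

/-- `G(ℂ((z)))`. -/
def loopGroup : Subgroup (LoopGL V) := chevalley H V Set.univ

/-- The group of germs of meromorphic `G`-valued functions, given by their Laurent expansions:
the Chevalley group over the field of convergent Laurent series. -/
def meroGroup : Subgroup (LoopGL V) := chevalley H V convergent

/-- `K = G(ℂ[[z]])`: the elements of `G(ℂ((z)))` which, together with their inverses, have
coefficients in `ℂ[[z]]`. -/
def taylorGroup : Subgroup (LoopGL V) :=
  loopGroup H V ⊓ MulAction.stabilizer (LoopGL V) (taylorLattice V : Set (LaurentModule V))

/-- The group of germs of holomorphic `G`-valued functions. -/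
def holoGroup : Subgroup (LoopGL V) :=
  meroGroup H V ⊓ MulAction.stabilizer (LoopGL V) (taylorLattice V : Set (LaurentModule V))

/-- Constants: `GL(V)` acting on `V((z))` coefficientwise. -/
def constGL : LinearMap.GeneralLinearGroup ℂ V →* LoopGL V :=
  Units.map (Module.End.baseChangeHom ℂ ℂ⸨X⸩ V).toMonoidHom

/-- `G(ℂ) ⊆ GL(V)`. -/
def constGroup : Subgroup (LinearMap.GeneralLinearGroup ℂ V) :=
  (chevalley H V (Set.range (algebraMap ℂ ℂ⸨X⸩))).comap (constGL V)

variable {H} in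
/-- The chamber `(L_V^*)_+` defined by the base `b`: those `h ∈ L_V^*` with `α(h) ∈ ℤ_{≥ 0}` for all
positive roots `α`. -/
def dominantChamber (b : (LieAlgebra.IsKilling.rootSystem H).Base) : Set H :=
  {h | h ∈ dualWeightLattice H V ∧
    ∀ i : H.root, b.IsPos i → ∃ n : ℕ, (i : LieModule.Weight ℂ H 𝔤) h = (n : ℂ)}

variable {H} in
/-- `χ` is the highest weight of `V` with respect to the base `b`: there is a nonzero vector of
weight `χ` that is killed by all root vectors of positive roots. -/
def IsHighestWeight (b : (LieAlgebra.IsKilling.rootSystem H).Base) (χ : H → ℂ) : Prop :=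
  ∃ v ∈ LieModule.weightSpace V χ, v ≠ 0 ∧
    ∀ i : H.root, b.IsPos i →
      ∀ x ∈ LieAlgebra.rootSpace H (i : LieModule.Weight ℂ H 𝔤), ⁅x, v⁆ = 0

variable {H}

/-! ### Flags -/

/-- The grading `V = ⨁ V_i`, `V_i = {v | h v = - i v}`. -/
def gradedPiece (h : H) (i : ℤ) : Submodule ℂ V :=
  (LieModule.toEnd ℂ 𝔤 V (h : 𝔤)).eigenspace (-(i : ℂ))

/-- The flag `F_j = ⨁_{s ≤ j} V_s`. -/
def flag (h : H) (j : ℤ) : Submodule ℂ V := ⨆ s : ℤ, ⨆ _ : s ≤ j, gradedPiece V h s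

/-- The Laurent series `∑ f_j z^j` with `f_j ∈ F_j` for all `j`. -/
def flagLattice (h : H) : Submodule ℂ (LaurentModule V) :=
  ⨅ j : ℤ, (flag V h j).comap (vcoeff j)

/-- `G_γ`: the stabilizer in `G(ℂ((z)))` of the flag determined by `h`. -/
def flagStabilizer (h : H) : Subgroup (LoopGL V) :=
  loopGroup H V ⊓ MulAction.stabilizer (LoopGL V) (flagLattice V h : Set (LaurentModule V))

/-- `K_γ = K ∩ G_γ` as a subgroup of `K`. -/
def taylorFlagStabilizer (h : H) : Subgroup (taylorGroup H V) :=
  (flagStabilizer V h).subgroupOf (taylorGroup H V)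

/-- `K_0 = ∏ K_γ ⊆ ∏ K`. -/
def K₀ {ι : Type*} (h : ι → H) : Subgroup (ι → taylorGroup H V) :=
  Subgroup.pi Set.univ fun γ => taylorFlagStabilizer V (h γ)

end Chevalley

/-! ### Matrix divisors on a Riemann surface -/

/-- A choice of a holomorphic local coordinate, vanishing at `x`, for every point `x`. -/
structure LocalCoordinates (S : Type*) [TopologicalSpace S] [ChartedSpace ℂ S] where
  chart : S → OpenPartialHomeomorph S ℂ
  mem_atlas : ∀ x, chart x ∈ IsManifold.maximalAtlas 𝓘(ℂ) ω S
  mem_source : ∀ x, x ∈ (chart x).source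
  centered : ∀ x, chart x x = 0

/-- `s ∈ V((z))` is the Laurent expansion at `x` of the `V`-valued function `f`, in the given
coordinate `z` at `x`. -/
def HasLaurentExpansion {S : Type*} [TopologicalSpace S] [ChartedSpace ℂ S]
    {V : Type*} [AddCommGroup V] [Module ℂ V]
    (c : LocalCoordinates S) (f : S → V) (x : S) (s : LaurentModule V) : Prop :=
  ∀ᶠ y in 𝓝[≠] x, ∀ φ : Module.Dual ℂ V,
    HasSum (fun n : ℤ => c.chart x y ^ n * φ (vcoeff n s)) (φ (f y))

/-- `f` is holomorphic on `U ∖ Γ`, has at most poles at the points of `U ∩ Γ`, and its Laurent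
expansion at each `γ ∈ U ∩ Γ` belongs to `L γ`. The values of `f` off `U ∖ Γ` are irrelevant. -/
def IsLocalSection {S : Type*} [TopologicalSpace S] [ChartedSpace ℂ S]
    {V : Type*} [AddCommGroup V] [Module ℂ V]
    (c : LocalCoordinates S) (Γ : Finset S) (L : Γ → Set (LaurentModule V))
    (U : TopologicalSpace.Opens S) (f : S → V) : Prop :=
  (∀ φ : Module.Dual ℂ V, MDifferentiableOn 𝓘(ℂ) 𝓘(ℂ) (fun y => φ (f y)) ((U : Set S) \ Γ)) ∧
    ∀ γ : Γ, (γ : S) ∈ U → ∃ s ∈ L γ, HasLaurentExpansion c f γ s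

section Divisors

variable {𝔤 : Type*} [LieRing 𝔤] [LieAlgebra ℂ 𝔤] [FiniteDimensional ℂ 𝔤]
  [LieAlgebra.IsSemisimple ℂ 𝔤]
  (H : LieSubalgebra ℂ 𝔤) [H.IsCartanSubalgebra]
  (V : Type*) [AddCommGroup V] [Module ℂ V] [LieRingModule 𝔤 V] [LieModule ℂ 𝔤 V]
  [FiniteDimensional ℂ V]
  {S : Type*} (Γ : Finset S)

/-- A distribution with support `Γ`: a germ of a meromorphic `G`-valued function at every point
`x`, written in the local coordinate at `x`, which is holomorphic for `x ∉ Γ`. -/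
@[ext]
structure GermDistribution where
  germ : S → LoopGL V
  mem_mero : ∀ x, germ x ∈ meroGroup H V
  mem_holo : ∀ x, x ∉ Γ → germ x ∈ holoGroup H V

variable {H V Γ}

/-- `A` and `B` are equivalent if `C A = B` for a distribution `C` holomorphic everywhere. -/
def GermDistribution.Equivalent (A B : GermDistribution H V Γ) : Prop :=
  ∃ C : S → LoopGL V, (∀ x, C x ∈ holoGroup H V) ∧ ∀ x, C x * A.germ x = B.germ x

variable (H V Γ) in
/-- Equivalence of distributions as a setoid. -/
def GermDistribution.setoid : Setoid (GermDistribution H V Γ) where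
  r := GermDistribution.Equivalent
  iseqv :=
    { refl := fun _ => ⟨fun _ => 1, fun _ => one_mem _, fun _ => one_mul _⟩
      symm := fun ⟨C, hC, h⟩ =>
        ⟨fun x => (C x)⁻¹, fun x => inv_mem (hC x), fun x => by rw [← h x, inv_mul_cancel_left]⟩
      trans := fun ⟨C, hC, h⟩ ⟨D, hD, k⟩ =>
        ⟨fun x => D x * C x, fun x => mul_mem (hD x) (hC x),
          fun x => by rw [mul_assoc, h x, k x]⟩ }

variable (H V Γ) in
/-- A matrix divisor is an equivalence class of distributions. -/
def MatrixDivisor : Type _ := Quotient (GermDistribution.setoid H V Γ)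

/-- The class of a distribution. -/
def GermDistribution.toDivisor (Ψ : GermDistribution H V Γ) : MatrixDivisor H V Γ :=
  Quotient.mk (GermDistribution.setoid H V Γ) Ψ

/-- The expansions `s` at `γ` for which `Ψ_γ s` is holomorphic. -/
def GermDistribution.stalk (Ψ : GermDistribution H V Γ) (γ : Γ) : Set (LaurentModule V) :=
  {s | Ψ.germ γ • s ∈ taylorLattice V}

theorem GermDistribution.Equivalent.stalk_eq {A B : GermDistribution H V Γ} (h : A.Equivalent B) :
    A.stalk = B.stalk := by
  obtain ⟨C, hC, hAB⟩ := h
  funext γ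
  ext s
  have h2 : C γ • (taylorLattice V : Set (LaurentModule V)) = taylorLattice V := (hC γ).2
  change A.germ γ • s ∈ (taylorLattice V : Set (LaurentModule V)) ↔
    B.germ γ • s ∈ (taylorLattice V : Set (LaurentModule V))
  rw [← hAB γ, mul_smul]
  conv_rhs => rw [← h2]
  exact Set.smul_mem_smul_set_iff.symm

/-- `stalk` depends on the matrix divisor only. -/
def MatrixDivisor.stalk (D : MatrixDivisor H V Γ) : Γ → Set (LaurentModule V) :=
  Quotient.lift GermDistribution.stalk (fun _ _ h => GermDistribution.Equivalent.stalk_eq h) D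

/-- The sheaf of sections of a matrix divisor: `f` is a meromorphic `V`-valued function on `U`,
holomorphic on `U ∖ Γ`, such that `Ψ_γ f` is holomorphic near each `γ ∈ U ∩ Γ`. -/
def MatrixDivisor.IsSection [TopologicalSpace S] [ChartedSpace ℂ S] (c : LocalCoordinates S)
    (D : MatrixDivisor H V Γ) (U : TopologicalSpace.Opens S) (f : S → V) : Prop :=
  IsLocalSection c Γ D.stalk U f

/-- `Ψ` has toric invariants `h`: at each `γ ∈ Γ`, the Cartan decomposition of `Ψ_γ` has the form
`k z^{h_γ} k'`. -/
def GermDistribution.HasInvariants (Ψ : GermDistribution H V Γ) (h : Γ → H) : Prop :=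
  ∀ γ : Γ, ∃ k ∈ holoGroup H V, ∃ k' ∈ holoGroup H V, ∃ u : LoopGL V,
    IsTorusElement H V (h γ) zSeries u ∧ Ψ.germ γ = k * u * k'

theorem GermDistribution.Equivalent.hasInvariants {A B : GermDistribution H V Γ} (hAB : A.Equivalent B)
    {h : Γ → H} (hA : A.HasInvariants h) : B.HasInvariants h := by
  obtain ⟨C, hC, hCAB⟩ := hAB
  intro γ
  obtain ⟨k, hk, k', hk', u, hu, e⟩ := hA γ
  exact ⟨C γ * k, mul_mem (hC γ) hk, k', hk', u, hu, by rw [← hCAB γ, e]; simp only [mul_assoc]⟩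

/-- `HasInvariants` depends on the matrix divisor only. -/
def MatrixDivisor.HasInvariants (h : Γ → H) (D : MatrixDivisor H V Γ) : Prop :=
  Quotient.lift (fun Ψ : GermDistribution H V Γ => Ψ.HasInvariants h)
    (fun _ _ hAB => propext ⟨GermDistribution.Equivalent.hasInvariants hAB,
      GermDistribution.Equivalent.hasInvariants ((GermDistribution.setoid H V Γ).symm hAB)⟩) D

variable [TopologicalSpace S] [ChartedSpace ℂ S]

variable (V) in
/-- Matrix divisors with invariants `h`, identified when they have the same sheaf of sections. -/
def moduliSetoid (c : LocalCoordinates S) (h : Γ → H) :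
    Setoid {D : MatrixDivisor H V Γ // D.HasInvariants h} where
  r D D' := ∀ U f, D.1.IsSection c U f ↔ D'.1.IsSection c U f
  iseqv :=
    { refl := fun _ _ _ => Iff.rfl
      symm := fun h U f => (h U f).symm
      trans := fun h k U f => (h U f).trans (k U f) }

variable (V) in
/-- The moduli space of matrix divisors with invariants `h` and fixed support `Γ`. -/
def ModuliSpace (c : LocalCoordinates S) (h : Γ → H) : Type _ := Quotient (moduliSetoid V c h)

/-- The sections of a point of the moduli space. -/
def ModuliSpace.IsSection {c : LocalCoordinates S} {h : Γ → H} (m : ModuliSpace V c h)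
    (U : TopologicalSpace.Opens S) (f : S → V) : Prop :=
  Quotient.lift (fun D : {D : MatrixDivisor H V Γ // D.HasInvariants h} => D.1.IsSection c U f)
    (fun D D' (hD : ∀ U f, D.1.IsSection c U f ↔ D'.1.IsSection c U f) => propext (hD U f)) m

/-- The point of the moduli space defined by a distribution with invariants `h`. -/
def GermDistribution.toModuli (c : LocalCoordinates S) {h : Γ → H} (Ψ : GermDistribution H V Γ)
    (hΨ : Ψ.HasInvariants h) : ModuliSpace V c h :=
  Quotient.mk (moduliSetoid V c h) ⟨Ψ.toDivisor, hΨ⟩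

/-- The sheaf of sections of `m'` is the left shift by the constant `g ∈ G(ℂ)` of that of `m`. -/
def ModuliSpace.IsShift {c : LocalCoordinates S} {h : Γ → H} (g : LinearMap.GeneralLinearGroup ℂ V)
    (m m' : ModuliSpace V c h) : Prop :=
  ∀ U f, m.IsSection U f ↔ m'.IsSection U fun y => g • f y

end Divisors

end MatrixDivisors

end

/-! Everything is read off from lattices in `V((z))`. The admissible expansions at `γ` of a divisor
with germ `Ψ_γ` form the lattice `Ψ_γ⁻¹ V[[z]]`, which does not change when `Ψ_γ` is multiplied on
the left by a holomorphic germ. These lattices and the sheaf of sections determine each other: a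
formal element of a lattice is a Laurent polynomial plus a tail of high order, the tail lies in both
of the lattices to be compared, and the polynomial in the local coordinate is a genuine local
section (`smul_taylorLattice_subset_of_isLocalSection`). So the moduli space embeds in the set of
families of lattices.

An irreducible module with a nonzero weight vector is the sum of its weight spaces, and comparing
coefficients on them gives `F_h = z^(-h) V[[z]]` (`flagLattice_eq_smul`). Hence `Ψ_γ = k z^h k'` has
the lattice `k'⁻¹ F_h`, and the image lies in the `K^Γ`-orbit of the flag lattices.

The image is the whole orbit, although `K` consists of formal loops and divisors are built from
convergent ones. Parameters of root and torus elements can be truncated, so convergent loops are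
`z`-adically dense in the loop group (`loopGroup_le_adicClosure`). A sufficiently deep congruence
subgroup stabilizes `F_h`, so each `k F_h` equals some `p F_h` with `p` convergent
(`exists_holoGroup_smul_flagLattice`).

Finally `K₀` is the stabilizer of the family of flag lattices, and the orbit-stabilizer theorem
gives the quotient. The action is transported from the orbit. A constant `g` moves sections as it
moves lattices, which gives the statement on shifts. -/

noncomputable section

namespace MatrixDivisors

/-! ### The `z`-adic filtration -/

section Filtration

variable {V : Type*} [AddCommGroup V] [Module ℂ V]

@[simp]
theorem vcoeff_tmul (n : ℤ) (a : ℂ⸨X⸩) (v : V) : vcoeff n (a ⊗ₜ[ℂ] v) = a.coeff n • v := by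
  simp [vcoeff]

/-- The Laurent series `φ(s) = ∑ φ(s_n) z^n` for a linear form `φ` on `V`. -/
def component (φ : Module.Dual ℂ V) : LaurentModule V →ₗ[ℂ⸨X⸩] ℂ⸨X⸩ :=
  (TensorProduct.AlgebraTensorModule.rid ℂ ℂ⸨X⸩ ℂ⸨X⸩).toLinearMap ∘ₗ LinearMap.baseChange ℂ⸨X⸩ φ

@[simp]
theorem component_tmul (φ : Module.Dual ℂ V) (a : ℂ⸨X⸩) (v : V) :
    component φ (a ⊗ₜ[ℂ] v) = φ v • a := by
  simp [component]

theorem coeff_component (φ : Module.Dual ℂ V) (s : LaurentModule V) (n : ℤ) :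
    (component φ s).coeff n = φ (vcoeff n s) := by
  induction s using TensorProduct.induction_on with
  | zero => simp
  | tmul a v => simp [mul_comm]
  | add x y hx hy => simp [hx, hy]

/-- Coordinates on `V((z))`: they reduce estimates of order to scalar series. -/
theorem sum_component_tmul {ι : Type*} [Fintype ι] (b : Module.Basis ι ℂ V) (s : LaurentModule V) :
    ∑ i, component (b.coord i) s ⊗ₜ[ℂ] b i = s := by
  induction s using TensorProduct.induction_on with
  | zero => simp
  | tmul a v =>
    simp only [component_tmul, TensorProduct.smul_tmul, ← TensorProduct.tmul_sum]
    congr 1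
    exact b.sum_repr v
  | add x y hx hy => simp only [map_add, TensorProduct.add_tmul, Finset.sum_add_distrib, hx, hy]

theorem ext_vcoeff [FiniteDimensional ℂ V] {s t : LaurentModule V}
    (h : ∀ n, vcoeff n s = vcoeff n t) : s = t := by
  let b := Module.finBasis ℂ V
  rw [← sum_component_tmul b s, ← sum_component_tmul b t]
  refine Finset.sum_congr rfl fun i _ => ?_
  congr 1
  ext n
  rw [coeff_component, coeff_component, h]

theorem vcoeff_single_smul (k n : ℤ) (s : LaurentModule V) :
    vcoeff n ((HahnSeries.single k (1 : ℂ) : ℂ⸨X⸩) • s) = vcoeff (n - k) s := by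
  induction s using TensorProduct.induction_on with
  | zero => simp
  | tmul a v =>
    have : ((HahnSeries.single k (1 : ℂ) : ℂ⸨X⸩) * a).coeff n = a.coeff (n - k) := by
      have := HahnSeries.coeff_single_mul_add (r := (1 : ℂ)) (x := a) (a := n - k) (b := k)
      simpa using this
    rw [TensorProduct.smul_tmul', smul_eq_mul, vcoeff_tmul, vcoeff_tmul, this]
  | add x y hx hy => simp only [map_add, smul_add, hx, hy]

variable (V) in
/-- The lattice `z^N V[[z]]`. -/
def filtration (N : ℤ) : Submodule ℂ (LaurentModule V) where
  carrier := {s | ∀ n < N, vcoeff n s = 0}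
  add_mem' ha hb n hn := by rw [map_add, ha n hn, hb n hn, add_zero]
  zero_mem' n _ := map_zero _
  smul_mem' c x hx n hn := by rw [map_smul, hx n hn, smul_zero]

theorem filtration_anti {M N : ℤ} (h : M ≤ N) : filtration V N ≤ filtration V M :=
  fun _ hs n hn => hs n (hn.trans_le h)

theorem tmul_mem_filtration {N : ℤ} {a : ℂ⸨X⸩} (ha : ∀ n < N, a.coeff n = 0) (v : V) :
    a ⊗ₜ[ℂ] v ∈ filtration V N := fun n hn => by rw [vcoeff_tmul, ha n hn, zero_smul]

theorem coeff_mul_eq_zero {M N : ℤ} {a c : ℂ⸨X⸩} (ha : ∀ n < M, a.coeff n = 0)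
    (hc : ∀ n < N, c.coeff n = 0) : ∀ n < M + N, (a * c).coeff n = 0 := by
  intro n hn
  rw [HahnSeries.coeff_mul]
  refine Finset.sum_eq_zero fun p hp => ?_
  rw [Finset.mem_antidiagonal] at hp
  rcases lt_or_ge p.1 M with h | h
  · rw [ha _ h, zero_mul]
  · rw [hc p.2 (by omega), mul_zero]

theorem smul_mem_filtration [FiniteDimensional ℂ V] {M N : ℤ} {a : ℂ⸨X⸩}
    (ha : ∀ n < M, a.coeff n = 0) {s : LaurentModule V} (hs : s ∈ filtration V N) :
    a • s ∈ filtration V (M + N) := by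
  rw [← sum_component_tmul (Module.finBasis ℂ V) s, Finset.smul_sum]
  refine Submodule.sum_mem _ fun i _ => ?_
  rw [TensorProduct.smul_tmul', smul_eq_mul]
  refine tmul_mem_filtration (coeff_mul_eq_zero ha fun n hn => ?_) _
  rw [coeff_component, hs n hn, map_zero]

theorem exists_coeff_eq_zero (a : ℂ⸨X⸩) : ∃ N : ℤ, ∀ n < N, a.coeff n = 0 :=
  ⟨a.order, fun _ hn => HahnSeries.coeff_eq_zero_of_lt_order hn⟩

theorem exists_mem_filtration (s : LaurentModule V) : ∃ N : ℤ, s ∈ filtration V N := by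
  induction s using TensorProduct.induction_on with
  | zero => exact ⟨0, zero_mem _⟩
  | tmul a v =>
    obtain ⟨N, hN⟩ := exists_coeff_eq_zero a
    exact ⟨N, tmul_mem_filtration hN v⟩
  | add x y hx hy =>
    obtain ⟨M, hM⟩ := hx
    obtain ⟨N, hN⟩ := hy
    exact ⟨min M N, add_mem (filtration_anti (min_le_left M N) hM)
      (filtration_anti (min_le_right M N) hN)⟩

variable (V) in
/-- The algebra `End(V((z)))`. -/
abbrev LoopEnd : Type _ := Module.End ℂ⸨X⸩ (LaurentModule V)

/-- `A` maps `z^M V[[z]]` to `z^(M+N) V[[z]]` for all `M`. -/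
def ShiftsBy (A : LoopEnd V) (N : ℤ) : Prop :=
  ∀ M, ∀ s ∈ filtration V M, A s ∈ filtration V (M + N)

theorem shiftsBy_of_forall_tmul [FiniteDimensional ℂ V] {A : LoopEnd V} {N : ℤ}
    (hA : ∀ v, A (1 ⊗ₜ[ℂ] v) ∈ filtration V N) : ShiftsBy A N := by
  intro M s hs
  rw [← sum_component_tmul (Module.finBasis ℂ V) s, map_sum]
  refine Submodule.sum_mem _ fun i _ => ?_
  rw [show component ((Module.finBasis ℂ V).coord i) s ⊗ₜ[ℂ] Module.finBasis ℂ V i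
    = component ((Module.finBasis ℂ V).coord i) s • (1 : ℂ⸨X⸩) ⊗ₜ[ℂ] Module.finBasis ℂ V i by
      rw [TensorProduct.smul_tmul', smul_eq_mul, mul_one], map_smul]
  refine smul_mem_filtration (fun n hn => ?_) (hA _)
  rw [coeff_component, hs n hn, map_zero]

/-- The finitely many columns of the matrix of `A` have poles of bounded order. -/
theorem exists_shiftsBy [FiniteDimensional ℂ V] (A : LoopEnd V) : ∃ N : ℤ, ShiftsBy A N := by
  let b := Module.finBasis ℂ V
  choose N hN using fun i => exists_mem_filtration (A (1 ⊗ₜ[ℂ] b i))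
  obtain ⟨M, hM⟩ := (Set.finite_range N).bddBelow
  refine ⟨M, shiftsBy_of_forall_tmul fun v => ?_⟩
  rw [← b.sum_repr v, TensorProduct.tmul_sum, map_sum]
  refine Submodule.sum_mem _ fun i _ => ?_
  have : (1 : ℂ⸨X⸩) ⊗ₜ[ℂ] (b.repr v i • b i)
      = (algebraMap ℂ ℂ⸨X⸩ (b.repr v i)) • (1 : ℂ⸨X⸩) ⊗ₜ[ℂ] b i := by
    rw [← TensorProduct.smul_tmul, TensorProduct.smul_tmul', algebraMap_smul]
  rw [this, map_smul, algebraMap_smul]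
  exact Submodule.smul_mem _ _ (filtration_anti (hM ⟨i, rfl⟩) (hN i))


/-! ### Congruence subgroups -/

/-- `A` is congruent to `1` modulo `z^N`. -/
def CongruentOne (A : LoopEnd V) (N : ℤ) : Prop :=
  ∀ M, ∀ s ∈ filtration V M, A s - s ∈ filtration V (M + N)

theorem CongruentOne.mono {A : LoopEnd V} {M N : ℤ} (hA : CongruentOne A N) (h : M ≤ N) :
    CongruentOne A M := fun k _ hs => filtration_anti (add_le_add_right h k) (hA _ _ hs)

theorem CongruentOne.apply_mem {A : LoopEnd V} {N : ℕ} (hA : CongruentOne A N) {M : ℤ}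
    {s : LaurentModule V} (hs : s ∈ filtration V M) : A s ∈ filtration V M := by
  rw [← sub_add_cancel (A s) s]
  exact add_mem (filtration_anti (by omega) (hA M s hs)) hs

theorem CongruentOne.mul {A B : LoopEnd V} {N : ℕ} (hA : CongruentOne A N)
    (hB : CongruentOne B N) : CongruentOne (A * B) N := fun M s hs => by
  rw [Module.End.mul_apply, ← sub_add_sub_cancel _ (B s) s]
  exact add_mem (hA _ _ (hB.apply_mem hs)) (hB _ _ hs)

theorem congruentOne_of_forall_tmul [FiniteDimensional ℂ V] {A : LoopEnd V} {N : ℤ}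
    (hA : ∀ v : V, A (1 ⊗ₜ[ℂ] v) - 1 ⊗ₜ[ℂ] v ∈ filtration V N) : CongruentOne A N := by
  intro M s hs
  have h : s = ∑ i, component ((Module.finBasis ℂ V).coord i) s •
      ((1 : ℂ⸨X⸩) ⊗ₜ[ℂ] Module.finBasis ℂ V i) := by
    conv_lhs => rw [← sum_component_tmul (Module.finBasis ℂ V) s]
    simp only [TensorProduct.smul_tmul', smul_eq_mul, mul_one]
  have h' : A s - s = ∑ i, component ((Module.finBasis ℂ V).coord i) s •
      (A ((1 : ℂ⸨X⸩) ⊗ₜ[ℂ] Module.finBasis ℂ V i) - 1 ⊗ₜ[ℂ] Module.finBasis ℂ V i) := by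
    simp only [smul_sub, ← map_smul]
    have e (f g : Fin (Module.finrank ℂ V) → LaurentModule V) :
        ∑ i, (f i - g i) = ∑ i, f i - ∑ i, g i := Finset.sum_sub_distrib f g
    rw [e]
    exact congrArg₂ _ ((congrArg A h).trans (map_sum A _ _)) h
  rw [h']
  refine Submodule.sum_mem _ fun i _ => smul_mem_filtration (fun n hn => ?_) (hA _)
  rw [coeff_component, hs n hn, map_zero]

variable (V) in
/-- The automorphisms congruent to `1` modulo `z^N`, together with their inverses. -/
def congruence (N : ℕ) : Subgroup (LoopGL V) where
  carrier := {g | CongruentOne (g : LoopEnd V) N ∧ CongruentOne ((g⁻¹ : LoopGL V) : LoopEnd V) N}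
  one_mem' := by
    have : CongruentOne (1 : LoopEnd V) N := fun M s _ => by simp
    exact ⟨this, this⟩
  inv_mem' h := by
    simp only [Set.mem_ofPred_eq, inv_inv] at h ⊢
    exact h.symm
  mul_mem' ha hb := ⟨ha.1.mul hb.1, by rw [mul_inv_rev]; exact hb.2.mul ha.2⟩

theorem mem_stabilizer_iff {g : LoopGL V} {L : Set (LaurentModule V)} :
    g ∈ MulAction.stabilizer (LoopGL V) L ↔ (∀ s ∈ L, g • s ∈ L) ∧ ∀ s ∈ L, g⁻¹ • s ∈ L := by
  rw [MulAction.mem_stabilizer_iff]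
  constructor
  · intro h
    refine ⟨fun s hs => h ▸ Set.smul_mem_smul_set hs, fun s hs => ?_⟩
    rwa [← Set.mem_smul_set_iff_inv_smul_mem, h]
  · rintro ⟨h1, h2⟩
    ext s
    rw [Set.mem_smul_set_iff_inv_smul_mem]
    exact ⟨fun h => by simpa using h1 _ h, h2 s⟩

theorem congruence_le_stabilizer (N : ℕ) : congruence V N ≤
    MulAction.stabilizer (LoopGL V) (taylorLattice V : Set (LaurentModule V)) := fun _ hg =>
  mem_stabilizer_iff.2 ⟨fun _ hs => hg.1.apply_mem (M := 0) hs,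
    fun _ hs => hg.2.apply_mem (M := 0) hs⟩

/-- Conjugation is `z`-adically continuous: `a` and `a⁻¹` lower orders by a bounded amount only.
This makes `adicClosure` a subgroup, and is used again with `a = z^h`. -/
theorem exists_conj_congruence [FiniteDimensional ℂ V] (a : LoopGL V) (N : ℕ) :
    ∃ M : ℕ, ∀ g ∈ congruence V M, a * g * a⁻¹ ∈ congruence V N := by
  obtain ⟨p, hp⟩ := exists_shiftsBy (a : LoopEnd V)
  obtain ⟨q, hq⟩ := exists_shiftsBy ((a⁻¹ : LoopGL V) : LoopEnd V)
  have key : ∀ g : LoopGL V, CongruentOne (g : LoopEnd V) (N + p.natAbs + q.natAbs : ℕ) →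
      CongruentOne ((a * g * a⁻¹ : LoopGL V) : LoopEnd V) N := by
    intro g hg M s hs
    have h1 := hp _ _ (hg _ _ (hq M s hs))
    have h2 : (a : LoopEnd V) (((a⁻¹ : LoopGL V) : LoopEnd V) s) = s := by
      rw [← Module.End.mul_apply, Units.mul_inv, Module.End.one_apply]
    rw [map_sub, h2] at h1
    exact filtration_anti (by omega) h1
  refine ⟨N + p.natAbs + q.natAbs, fun g hg => ⟨key g hg.1, ?_⟩⟩
  have := key g⁻¹ hg.2
  rwa [← conj_inv] at this

/-- The closure of a subgroup in the `z`-adic topology. -/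
def adicClosure [FiniteDimensional ℂ V] (P : Subgroup (LoopGL V)) : Subgroup (LoopGL V) where
  carrier := {g | ∀ N : ℕ, ∃ p ∈ P, p⁻¹ * g ∈ congruence V N}
  one_mem' N := ⟨1, one_mem _, by simp⟩
  mul_mem' := by
    intro a b ha hb N
    obtain ⟨q, hq, hqb⟩ := hb N
    obtain ⟨M, hM⟩ := exists_conj_congruence q⁻¹ N
    obtain ⟨p, hp, hpa⟩ := ha M
    refine ⟨p * q, mul_mem hp hq, ?_⟩
    have := mul_mem (hM _ hpa) hqb
    rwa [show q⁻¹ * (p⁻¹ * a) * q⁻¹⁻¹ * (q⁻¹ * b) = (p * q)⁻¹ * (a * b) by group] at this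
  inv_mem' := by
    intro a ha N
    obtain ⟨M, hM⟩ := exists_conj_congruence a N
    obtain ⟨p, hp, hpa⟩ := ha M
    refine ⟨p⁻¹, inv_mem hp, ?_⟩
    have := hM _ (inv_mem hpa)
    rwa [show a * (p⁻¹ * a)⁻¹ * a⁻¹ = p⁻¹⁻¹ * a⁻¹ by group] at this

end Filtration

/-! ### Scalar Laurent series -/

section Scalars

theorem convergent_of_coeff_eq_zero {a : ℂ⸨X⸩} {N : ℤ} (h : ∀ n ≥ N, a.coeff n = 0) :
    a ∈ convergent := by
  refine ⟨1, one_pos, summable_of_ne_finset_zero (s := Finset.range N.toNat) fun n hn => ?_⟩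
  rw [Finset.mem_range, not_lt] at hn
  rw [h n (by omega)]
  simp

theorem zSeries_zpow (n : ℤ) : zSeries ^ n = HahnSeries.single n (1 : ℂ) := by
  have h0 (k : ℕ) : zSeries ^ k = HahnSeries.single (k : ℤ) (1 : ℂ) := by
    simp [zSeries, HahnSeries.single_pow]
  cases n with
  | ofNat k => simpa using h0 k
  | negSucc k =>
    rw [zpow_negSucc, h0]
    refine inv_eq_of_mul_eq_one_right ?_
    rw [HahnSeries.single_mul_single, mul_one, Int.negSucc_eq]
    simp

theorem exists_convergent_truncation (a : ℂ⸨X⸩) (N : ℤ) :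
    -- A truncated Laurent series is a Laurent polynomial, hence converges.
    ∃ c ∈ convergent, ∀ n < N, (a - c).coeff n = 0 := by
  refine ⟨HahnSeries.truncLT N a, convergent_of_coeff_eq_zero (N := N) fun n hn => ?_,
    fun n hn => ?_⟩
  · rw [HahnSeries.coeff_truncLT, if_neg hn.not_gt]
  · rw [HahnSeries.coeff_sub, HahnSeries.coeff_truncLT, if_pos hn, sub_self]

/-- The series congruent to `1` modulo `z^(N+1)`. -/
def principalUnits (N : ℕ) : Subgroup (ℂ⸨X⸩)ˣ where
  carrier := {a | ∀ n < (N + 1 : ℤ), ((a : ℂ⸨X⸩) - 1).coeff n = 0}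
  one_mem' := by simp
  mul_mem' {a b} ha hb n hn := by
    have h : ((a * b : (ℂ⸨X⸩)ˣ) : ℂ⸨X⸩) - 1 = (a - 1) * (b - 1) + ((a - 1) + (b - 1)) := by
      push_cast; ring
    rw [h, HahnSeries.coeff_add, HahnSeries.coeff_add, ha n hn, hb n hn,
      coeff_mul_eq_zero ha hb n (by omega)]
    simp
  inv_mem' {a} ha n hn := by
    have h0 : (a : ℂ⸨X⸩).coeff 0 ≠ 0 := by
      have := ha 0 (by omega)
      rw [HahnSeries.coeff_sub, sub_eq_zero] at this
      simp [this]
    have h1 : (a : ℂ⸨X⸩).order = 0 := by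
      refine le_antisymm (HahnSeries.order_le_of_coeff_ne_zero h0) ?_
      by_contra! hlt
      have h2 := ha _ (hlt.trans (by omega))
      rw [HahnSeries.coeff_sub, HahnSeries.coeff_one, if_neg hlt.ne, sub_zero] at h2
      exact a.ne_zero (HahnSeries.coeff_order_eq_zero.1 h2)
    have h2 : ((a⁻¹ : (ℂ⸨X⸩)ˣ) : ℂ⸨X⸩).order = 0 := by
      have := HahnSeries.order_mul a.ne_zero a⁻¹.ne_zero
      rw [Units.mul_inv, HahnSeries.order_one, h1] at this
      omega
    have h3 : ((a⁻¹ : (ℂ⸨X⸩)ˣ) : ℂ⸨X⸩) - 1 = -((a - 1) * (a⁻¹ : (ℂ⸨X⸩)ˣ)) := by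
      rw [sub_mul, Units.mul_inv]; ring
    rw [h3, HahnSeries.coeff_neg, neg_eq_zero]
    refine coeff_mul_eq_zero (M := N + 1) (N := 0) ha (fun k hk => ?_) n (by omega)
    exact HahnSeries.coeff_eq_zero_of_lt_order (h2 ▸ hk)

theorem exists_convergent_mul_inv_mem (a : (ℂ⸨X⸩)ˣ) (N : ℕ) :
    ∃ c : (ℂ⸨X⸩)ˣ, (c : ℂ⸨X⸩) ∈ convergent ∧ c⁻¹ * a ∈ principalUnits N := by
  -- Dividing the error by `a` costs `a.order`, so the truncation is made that much deeper. It keeps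
  -- the leading term, so `c ≠ 0`.
  obtain ⟨c, hc, hac⟩ := exists_convergent_truncation (a : ℂ⸨X⸩) ((a : ℂ⸨X⸩).order + N + 1)
  have hc0 : c ≠ 0 := by
    rintro rfl
    have := hac (a : ℂ⸨X⸩).order (by omega)
    rw [sub_zero] at this
    exact a.ne_zero (HahnSeries.coeff_order_eq_zero.1 this)
  refine ⟨Units.mk0 c hc0, hc, ?_⟩
  -- For the inverse the error is `-(a - c) a⁻¹`, which involves only the known order of `a⁻¹` and
  -- not that of `c⁻¹`.
  rw [← inv_mem_iff]
  intro n hn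
  have h : (((Units.mk0 c hc0)⁻¹ * a)⁻¹ : (ℂ⸨X⸩)ˣ) - (1 : ℂ⸨X⸩)
      = -((a - c) * (a⁻¹ : (ℂ⸨X⸩)ˣ)) := by
    rw [sub_mul, Units.mul_inv]
    simp [mul_comm]
  rw [h, HahnSeries.coeff_neg, neg_eq_zero]
  have ho : ((a⁻¹ : (ℂ⸨X⸩)ˣ) : ℂ⸨X⸩).order = -(a : ℂ⸨X⸩).order := by
    have := HahnSeries.order_mul a.ne_zero a⁻¹.ne_zero
    rw [Units.mul_inv, HahnSeries.order_one] at this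
    omega
  exact coeff_mul_eq_zero (N := -(a : ℂ⸨X⸩).order) hac
    (fun k hk => HahnSeries.coeff_eq_zero_of_lt_order (ho ▸ hk)) n (by omega)

end Scalars

/-! ### Exponentials -/

theorem expSum_mul {K M : Type*} [Field K] [CharZero K] [AddCommGroup M] [Module K M]
    (f : Module.End K M) {k : ℕ} (hf : f ^ k = 0) (s t : K) :
    (∑ n ∈ Finset.range k, ((n.factorial : K)⁻¹ * s ^ n) • f ^ n) *
      (∑ n ∈ Finset.range k, ((n.factorial : K)⁻¹ * t ^ n) • f ^ n) =
      ∑ n ∈ Finset.range k, ((n.factorial : K)⁻¹ * (s + t) ^ n) • f ^ n := by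
  -- `IsNilpotent.exp` is defined over `ℚ`; this structure gives access to its addition formula for
  -- commuting nilpotents.
  let _ : Algebra ℚ (Module.End K M) := Algebra.compHom _ (algebraMap ℚ K)
  have hq (q : ℚ) (A : Module.End K M) : q • A = (q : K) • A := by
    change (algebraMap ℚ K q) • A = _
    simp
  have hk (t : K) : (t • f) ^ k = 0 := by rw [smul_pow, hf, smul_zero]
  have hexp (t : K) : IsNilpotent.exp (t • f)
      = ∑ n ∈ Finset.range k, ((n.factorial : K)⁻¹ * t ^ n) • f ^ n := by
    rw [IsNilpotent.exp_eq_sum (hk t)]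
    refine Finset.sum_congr rfl fun n _ => ?_
    rw [hq, smul_pow, smul_smul]
    simp
  rw [← hexp, ← hexp, ← hexp, add_smul, IsNilpotent.exp_add_of_commute
    (((Commute.refl f).smul_left s).smul_right t) ⟨k, hk s⟩ ⟨k, hk t⟩]

section Exp

variable {𝔤 : Type*} [LieRing 𝔤] [LieAlgebra ℂ 𝔤]
  {V : Type*} [AddCommGroup V] [Module ℂ V] [LieRingModule 𝔤 V] [LieModule ℂ 𝔤 V]

theorem expEnd_mul {x : 𝔤} (hx : IsNilpotent (LieModule.toEnd ℂ 𝔤 V x)) (s t : ℂ⸨X⸩) :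
    expEnd V x s * expEnd V x t = expEnd V x (s + t) := by
  have : CharZero ℂ⸨X⸩ := charZero_of_injective_algebraMap (algebraMap ℂ ℂ⸨X⸩).injective
  have h0 : LinearMap.baseChange ℂ⸨X⸩ (LieModule.toEnd ℂ 𝔤 V x)
      ^ nilpotencyClass (LieModule.toEnd ℂ 𝔤 V x) = 0 := by
    rw [← LinearMap.baseChange_pow, pow_nilpotencyClass hx, LinearMap.baseChange_zero]
  have h1 (t : ℂ⸨X⸩) : expEnd V x t
      = ∑ n ∈ Finset.range (nilpotencyClass (LieModule.toEnd ℂ 𝔤 V x)),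
        ((n.factorial : ℂ⸨X⸩)⁻¹ * t ^ n) •
          (LinearMap.baseChange ℂ⸨X⸩ (LieModule.toEnd ℂ 𝔤 V x)) ^ n := by
    refine Finset.sum_congr rfl fun n _ => ?_
    rw [map_inv₀, map_natCast, LinearMap.baseChange_pow]
  rw [h1, h1, h1]
  exact expSum_mul (K := ℂ⸨X⸩) (M := LaurentModule V) _ h0 s t

theorem expEnd_tmul_sub_mem {x : 𝔤} (hx : IsNilpotent (LieModule.toEnd ℂ 𝔤 V x)) {N : ℕ}
    {t : ℂ⸨X⸩} (ht : ∀ n < (N : ℤ), t.coeff n = 0) (v : V) :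
    expEnd V x t (1 ⊗ₜ[ℂ] v) - 1 ⊗ₜ[ℂ] v ∈ filtration V N := by
  have hpow (n : ℕ) : ∀ k < (N : ℤ), (t ^ (n + 1)).coeff k = 0 := by
    induction n with
    | zero => simpa using ht
    | succ n ih =>
      intro k hk
      rw [pow_succ]
      exact coeff_mul_eq_zero ih ht k (by omega)
  rcases hk : nilpotencyClass (LieModule.toEnd ℂ 𝔤 V x) with _ | k
  -- Nilpotency class zero means `1 = 0` on `V`, so every vector vanishes.
  · have h := pow_nilpotencyClass hx
    rw [hk, pow_zero] at h
    have hv : v = 0 := by simpa using LinearMap.congr_fun h v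
    rw [hv, TensorProduct.tmul_zero, map_zero]
    exact (sub_self (0 : LaurentModule V)).symm ▸ zero_mem _
  · have h1 : expEnd V x t (1 ⊗ₜ[ℂ] v) - 1 ⊗ₜ[ℂ] v = ∑ n ∈ Finset.range k,
        (algebraMap ℂ ℂ⸨X⸩ (((n + 1).factorial : ℂ)⁻¹) * t ^ (n + 1)) ⊗ₜ[ℂ]
          ((LieModule.toEnd ℂ 𝔤 V x) ^ (n + 1)) v := by
      rw [expEnd, hk, LinearMap.sum_apply, Finset.sum_range_succ', sub_eq_iff_eq_add]
      congr 1
      · refine Finset.sum_congr rfl fun n _ => ?_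
        rw [LinearMap.smul_apply, LinearMap.baseChange_tmul, TensorProduct.smul_tmul',
          smul_eq_mul, mul_one]
      · simp
    rw [h1]
    refine Submodule.sum_mem _ fun n _ => tmul_mem_filtration (fun j hj => ?_) _
    rw [← Algebra.smul_def, HahnSeries.coeff_smul, hpow n j hj, smul_zero]

theorem expEnd_zero {x : 𝔤} [FiniteDimensional ℂ V]
    (hx : IsNilpotent (LieModule.toEnd ℂ 𝔤 V x)) : expEnd V x 0 = 1 := by
  have key (v : V) : expEnd V x 0 (1 ⊗ₜ[ℂ] v) = 1 ⊗ₜ[ℂ] v := by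
    refine ext_vcoeff fun n => ?_
    -- The parameter `0` is divisible by every power of `z`; this exponent exceeds `n`.
    have := expEnd_tmul_sub_mem hx (N := (n + 1).toNat) (t := 0) (by simp) v n (by omega)
    rwa [map_sub, sub_eq_zero] at this
  refine TensorProduct.AlgebraTensorModule.curry_injective ?_
  ext v
  simpa using key v

/-- The root element `exp (t x)` of `GL(V((z)))`. -/
def expUnit [FiniteDimensional ℂ V] {x : 𝔤} (hx : IsNilpotent (LieModule.toEnd ℂ 𝔤 V x))
    (t : ℂ⸨X⸩) : LoopGL V where
  val := expEnd V x t
  inv := expEnd V x (-t)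
  val_inv := by rw [expEnd_mul hx, add_neg_cancel, expEnd_zero hx]
  inv_val := by rw [expEnd_mul hx, neg_add_cancel, expEnd_zero hx]

theorem expUnit_inv_mul_mem_congruence [FiniteDimensional ℂ V] {x : 𝔤}
    (hx : IsNilpotent (LieModule.toEnd ℂ 𝔤 V x)) {N : ℕ} {s t : ℂ⸨X⸩}
    (hst : ∀ n < (N : ℤ), (t - s).coeff n = 0) :
    (expUnit (V := V) hx s)⁻¹ * expUnit hx t ∈ congruence V N := by
  have h : (expUnit (V := V) hx s)⁻¹ * expUnit hx t = expUnit hx (t - s) := by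
    refine Units.ext ?_
    change expEnd V x (-s) * expEnd V x t = expEnd V x (t - s)
    rw [expEnd_mul hx, neg_add_eq_sub]
  rw [h]
  refine ⟨congruentOne_of_forall_tmul fun v => expEnd_tmul_sub_mem hx hst v,
    congruentOne_of_forall_tmul fun v => expEnd_tmul_sub_mem hx (t := -(t - s)) ?_ v⟩
  intro n hn
  rw [HahnSeries.coeff_neg, hst n hn, neg_zero]

end Exp

/-! ### Weight decomposition -/

section Weights

variable {𝔤 : Type*} [LieRing 𝔤] [LieAlgebra ℂ 𝔤] [FiniteDimensional ℂ 𝔤]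
  [LieAlgebra.IsSemisimple ℂ 𝔤]
  {H : LieSubalgebra ℂ 𝔤} [H.IsCartanSubalgebra]
  {V : Type*} [AddCommGroup V] [Module ℂ V] [LieRingModule 𝔤 V] [LieModule ℂ 𝔤 V]

/-- Root spaces are generalized weight spaces by definition, but semisimplicity makes `H` act on
them by scalars. Hence true weight spaces of `V`, not only generalized ones, are permuted. -/
theorem lie_mem_weightSpace_add {α β : H → ℂ} {x : 𝔤} (hx : x ∈ LieAlgebra.rootSpace H α) {v : V}
    (hv : v ∈ LieModule.weightSpace V β) : ⁅x, v⁆ ∈ LieModule.weightSpace V (α + β) := by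
  rw [LieModule.mem_weightSpace] at hv ⊢
  intro h
  have h1 : ⁅(h : 𝔤), x⁆ = α h • x := LieAlgebra.IsKilling.lie_eq_smul_of_mem_rootSpace hx h
  have h2 : ⁅(h : 𝔤), v⁆ = β h • v := hv h
  change ⁅(h : 𝔤), ⁅x, v⁆⁆ = _
  rw [leibniz_lie, h1, h2, smul_lie, lie_smul, Pi.add_apply, add_smul]

variable [FiniteDimensional ℂ V]

/-- An irreducible module that contains a weight vector is the sum of its weight spaces. -/
theorem iSup_weightSpace_eq_top [LieModule.IsIrreducible ℂ 𝔤 V] {χ : H → ℂ} {v : V}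
    (hv : v ∈ LieModule.weightSpace V χ) (hv0 : v ≠ 0) :
    ⨆ μ : LieModule.Weight ℂ H V, (LieModule.weightSpace V (μ : H → ℂ)).toSubmodule = ⊤ := by
  let W : Submodule ℂ V := ⨆ μ : H → ℂ, (LieModule.weightSpace V μ).toSubmodule
  have hW (x : 𝔤) (w : V) (hw : w ∈ W) : ⁅x, w⁆ ∈ W := by
    have hx : x ∈ ⨆ α : H → ℂ, (LieAlgebra.rootSpace H α).toSubmodule := by
      have := LieModule.iSup_genWeightSpace_eq_top ℂ H 𝔤
      rw [← LieSubmodule.iSup_toSubmodule, this]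
      trivial
    induction hx using Submodule.iSup_induction' with
    | mem α x hx =>
      induction hw using Submodule.iSup_induction' with
      | mem β w hw => exact Submodule.mem_iSup_of_mem (α + β) (lie_mem_weightSpace_add hx hw)
      | zero => simp
      | add a b _ _ ha hb => rw [lie_add]; exact add_mem ha hb
    | zero => simp
    | add a b _ _ ha hb => rw [add_lie]; exact add_mem ha hb
  let W' : LieSubmodule ℂ 𝔤 V := { W with lie_mem := fun {x w} hw => hW x w hw }
  have hvW : v ∈ W := Submodule.mem_iSup_of_mem χ hv
  have hW' : W' = ⊤ := by
    refine (eq_bot_or_eq_top W').resolve_left fun h => hv0 ?_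
    have : v ∈ W' := hvW
    rwa [h, LieSubmodule.mem_bot] at this
  have hWtop : W = ⊤ := congrArg LieSubmodule.toSubmodule hW'
  rw [eq_top_iff, ← hWtop]
  refine iSup_le fun μ => ?_
  -- Characters that are not weights contribute nothing to the sum.
  by_cases hμ : LieModule.genWeightSpace V μ = ⊥
  · intro w hw
    have := LieModule.weightSpace_le_genWeightSpace V μ hw
    rw [hμ, LieSubmodule.mem_bot] at this
    rw [this]
    exact zero_mem _
  · exact le_iSup (fun μ : LieModule.Weight ℂ H V =>
      (LieModule.weightSpace V (μ : H → ℂ)).toSubmodule) ⟨μ, hμ⟩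

variable (H V) in
/-- The module is the sum of its weight spaces. -/
def IsWeightModule : Prop :=
  ⨆ μ : LieModule.Weight ℂ H V, (LieModule.weightSpace V (μ : H → ℂ)).toSubmodule = ⊤

open Classical in
theorem IsWeightModule.exists_projections (hV : IsWeightModule H V) :
    ∃ p : LieModule.Weight ℂ H V → V →ₗ[ℂ] V,
      (∀ (μ : LieModule.Weight ℂ H V) (v : V), p μ v ∈ LieModule.weightSpace V (μ : H → ℂ)) ∧
      (∀ v, ∑ μ, p μ v = v) ∧
      ∀ μ ν : LieModule.Weight ℂ H V, ∀ v ∈ LieModule.weightSpace V (μ : H → ℂ), p ν v =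
        if μ = ν then v else 0 := by
  let A : LieModule.Weight ℂ H V → Submodule ℂ V :=
    fun μ => (LieModule.weightSpace V (μ : H → ℂ)).toSubmodule
  have hind : iSupIndep A :=
    (LieSubmodule.iSupIndep_toSubmodule.mpr (LieModule.iSupIndep_genWeightSpace' ℂ H V)).mono
      fun μ => LieModule.weightSpace_le_genWeightSpace V μ
  have hint := DirectSum.isInternal_submodule_of_iSupIndep_of_iSup_eq_top hind hV
  let e := LinearEquiv.ofBijective (DirectSum.coeLinearMap A) hint
  have he (μ) (v : A μ) : e.symm v = DirectSum.lof ℂ _ (fun μ => A μ) μ v := by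
    rw [LinearEquiv.symm_apply_eq]
    exact (DirectSum.coeLinearMap_lof A μ v).symm
  refine ⟨fun μ => (A μ).subtype ∘ₗ DirectSum.component ℂ _ (fun μ => A μ) μ ∘ₗ e.symm.toLinearMap,
    fun μ v => Submodule.coe_mem _, fun v => ?_, fun μ ν v hv => ?_⟩
  · obtain ⟨w, rfl⟩ := e.surjective v
    simp only [LinearMap.comp_apply, LinearEquiv.coe_coe, LinearEquiv.symm_apply_apply]
    induction w using DirectSum.induction_on with
    | zero => simp
    | of μ w =>
      rw [Finset.sum_eq_single μ]
      · rw [← DirectSum.lof_eq_of ℂ, DirectSum.component.lof_self]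
        exact (DirectSum.coeLinearMap_lof A μ w).symm
      · intro ν _ hν
        rw [← DirectSum.lof_eq_of ℂ, DirectSum.component.of, dif_neg hν.symm, map_zero]
      · simp
    | add a b ha hb => simp only [map_add, Finset.sum_add_distrib, ha, hb]
  · simp only [LinearMap.comp_apply, LinearEquiv.coe_coe]
    rw [he μ ⟨v, hv⟩, DirectSum.component.of]
    split_ifs with h
    · subst h; rfl
    · rfl

/-- The projection of a weight module to a weight space. -/
def weightProj (hV : IsWeightModule H V) (μ : LieModule.Weight ℂ H V) : V →ₗ[ℂ] V :=
  hV.exists_projections.choose μ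

theorem weightProj_mem (hV : IsWeightModule H V) (μ : LieModule.Weight ℂ H V) (v : V) :
    weightProj hV μ v ∈ LieModule.weightSpace V (μ : H → ℂ) :=
  hV.exists_projections.choose_spec.1 μ v

theorem sum_weightProj (hV : IsWeightModule H V) (v : V) : ∑ μ, weightProj hV μ v = v :=
  hV.exists_projections.choose_spec.2.1 v

open Classical in
theorem weightProj_of_mem (hV : IsWeightModule H V) {μ : LieModule.Weight ℂ H V}
    (ν : LieModule.Weight ℂ H V) {v : V} (hv : v ∈ LieModule.weightSpace V (μ : H → ℂ)) :
    weightProj hV ν v = if μ = ν then v else 0 :=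
  hV.exists_projections.choose_spec.2.2 μ ν v hv

theorem IsWeightModule.end_ext (hV : IsWeightModule H V) {A B : LoopEnd V}
    (h : ∀ (μ : LieModule.Weight ℂ H V), ∀ v ∈ LieModule.weightSpace V (μ : H → ℂ),
      A (1 ⊗ₜ[ℂ] v) = B (1 ⊗ₜ[ℂ] v)) : A = B := by
  refine TensorProduct.AlgebraTensorModule.curry_injective ?_
  ext v
  change A (1 ⊗ₜ[ℂ] v) = B (1 ⊗ₜ[ℂ] v)
  rw [← sum_weightProj hV v, TensorProduct.tmul_sum, map_sum, map_sum]
  exact Finset.sum_congr rfl fun μ _ => h μ _ (weightProj_mem hV μ v)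

/-! ### The maximal torus -/

/-- The integer `μ(h)`. -/
def weightValue {h : H} (hh : h ∈ dualWeightLattice H V) (μ : LieModule.Weight ℂ H V) : ℤ :=
  (hh μ).choose

theorem coe_weightValue {h : H} (hh : h ∈ dualWeightLattice H V) (μ : LieModule.Weight ℂ H V) :
    μ h = (weightValue hh μ : ℂ) := (hh μ).choose_spec

theorem weightValue_eq {h : H} (hh : h ∈ dualWeightLattice H V) {μ : LieModule.Weight ℂ H V}
    {n : ℤ} (hn : μ h = (n : ℂ)) : weightValue hh μ = n := by
  rw [coe_weightValue hh] at hn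
  exact_mod_cast hn

/-- The endomorphism `t^h`. -/
def torusEnd (hV : IsWeightModule H V) {h : H} (hh : h ∈ dualWeightLattice H V) (t : ℂ⸨X⸩) :
    LoopEnd V :=
  ∑ μ, t ^ weightValue hh μ • LinearMap.baseChange ℂ⸨X⸩ (weightProj hV μ)

theorem torusEnd_tmul (hV : IsWeightModule H V) {h : H} (hh : h ∈ dualWeightLattice H V)
    (t : ℂ⸨X⸩) {μ : LieModule.Weight ℂ H V} {v : V}
    (hv : v ∈ LieModule.weightSpace V (μ : H → ℂ)) (a : ℂ⸨X⸩) :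
    torusEnd hV hh t (a ⊗ₜ[ℂ] v) = (t ^ weightValue hh μ * a) ⊗ₜ[ℂ] v := by
  classical
  rw [torusEnd, LinearMap.sum_apply, Finset.sum_eq_single μ]
  · rw [LinearMap.smul_apply, LinearMap.baseChange_tmul, weightProj_of_mem hV μ hv, if_pos rfl,
      TensorProduct.smul_tmul', smul_eq_mul]
  · intro ν _ hν
    rw [LinearMap.smul_apply, LinearMap.baseChange_tmul, weightProj_of_mem hV ν hv,
      if_neg hν.symm, TensorProduct.tmul_zero, smul_zero]
  · simp

theorem torusEnd_mul (hV : IsWeightModule H V) {h : H} (hh : h ∈ dualWeightLattice H V)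
    (s t : ℂ⸨X⸩) : torusEnd hV hh s * torusEnd hV hh t = torusEnd hV hh (s * t) :=
  hV.end_ext fun μ v hv => by
    rw [Module.End.mul_apply, torusEnd_tmul hV hh t hv, torusEnd_tmul hV hh s hv,
      torusEnd_tmul hV hh _ hv, mul_zpow, mul_one, mul_one]

theorem torusEnd_one (hV : IsWeightModule H V) {h : H} (hh : h ∈ dualWeightLattice H V) :
    torusEnd hV hh 1 = 1 :=
  hV.end_ext fun μ v hv => by
    rw [torusEnd_tmul hV hh _ hv, one_zpow, mul_one, Module.End.one_apply]

/-- The homomorphism `t ↦ t^h`. -/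
def torusHom (hV : IsWeightModule H V) {h : H} (hh : h ∈ dualWeightLattice H V) :
    (ℂ⸨X⸩)ˣ →* LoopGL V :=
  Units.map
    { toFun := torusEnd hV hh
      map_one' := torusEnd_one hV hh
      map_mul' := fun s t => (torusEnd_mul hV hh s t).symm }

theorem coe_torusHom (hV : IsWeightModule H V) {h : H} (hh : h ∈ dualWeightLattice H V)
    (t : (ℂ⸨X⸩)ˣ) : (torusHom hV hh t : LoopEnd V) = torusEnd hV hh (t : ℂ⸨X⸩) := rfl

theorem isTorusElement_iff (hV : IsWeightModule H V) {h : H} (hh : h ∈ dualWeightLattice H V)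
    {t : (ℂ⸨X⸩)ˣ} {u : LoopGL V} : IsTorusElement H V h t u ↔ u = torusHom hV hh t := by
  constructor
  · intro hu
    refine Units.ext (hV.end_ext fun μ v hv => ?_)
    rw [hu μ _ (coe_weightValue hh μ) v hv, coe_torusHom, torusEnd_tmul hV hh _ hv, mul_one]
  · rintro rfl μ n hn v hv
    rw [coe_torusHom, torusEnd_tmul hV hh _ hv, weightValue_eq hh hn, mul_one]

end Weights

/-! ### Density of the convergent loops -/

section Density

variable {𝔤 : Type*} [LieRing 𝔤] [LieAlgebra ℂ 𝔤] [FiniteDimensional ℂ 𝔤]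
  [LieAlgebra.IsSemisimple ℂ 𝔤]
  {H : LieSubalgebra ℂ 𝔤} [H.IsCartanSubalgebra]
  {V : Type*} [AddCommGroup V] [Module ℂ V] [LieRingModule 𝔤 V] [LieModule ℂ 𝔤 V]
  [FiniteDimensional ℂ V]

theorem torusHom_mem_congruence (hV : IsWeightModule H V) {h : H}
    (hh : h ∈ dualWeightLattice H V) {N : ℕ} {t : (ℂ⸨X⸩)ˣ} (ht : t ∈ principalUnits N) :
    torusHom hV hh t ∈ congruence V N := by
  have key (s : (ℂ⸨X⸩)ˣ) (hs : s ∈ principalUnits N) :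
      CongruentOne (torusHom hV hh s : LoopEnd V) N := by
    refine congruentOne_of_forall_tmul fun v => ?_
    have hv : v ∈ ⨆ μ : LieModule.Weight ℂ H V,
        (LieModule.weightSpace V (μ : H → ℂ)).toSubmodule := by
      rw [show _ = ⊤ from hV]; trivial
    induction hv using Submodule.iSup_induction' with
    | mem μ v hv =>
      rw [coe_torusHom, torusEnd_tmul hV hh _ hv, mul_one, ← TensorProduct.sub_tmul]
      refine tmul_mem_filtration (fun n hn => ?_) v
      have := zpow_mem hs (weightValue hh μ) n (by omega)
      rwa [Units.val_zpow_eq_zpow_val] at this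
    | zero =>
      rw [TensorProduct.tmul_zero, map_zero]
      exact (sub_self (0 : LaurentModule V)).symm ▸ zero_mem _
    | add a b _ _ ha hb =>
      have e (p q r s : LaurentModule V) : p + q - (r + s) = (p - r) + (q - s) :=
        add_sub_add_comm p q r s
      rw [TensorProduct.tmul_add, map_add, e]
      exact add_mem ha hb
  exact ⟨key t ht, by rw [← map_inv]; exact key _ (inv_mem ht)⟩

/-- The convergent loops are dense in the loop group for the `z`-adic topology. -/
theorem loopGroup_le_adicClosure (hV : IsWeightModule H V) :
    loopGroup H V ≤ adicClosure (meroGroup H V) := by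
  refine (Subgroup.closure_le _).2 ?_
  rintro u (⟨α, hα, x, hx, t, -, hu⟩ | ⟨h, hh, t, -, ht, hu⟩) N
  · by_cases hn : IsNilpotent (LieModule.toEnd ℂ 𝔤 V x)
    · obtain ⟨s, hs, hst⟩ := exists_convergent_truncation t N
      refine ⟨expUnit hn s, Subgroup.subset_closure (Or.inl ⟨α, hα, x, hx, s, hs, rfl⟩), ?_⟩
      rw [show u = expUnit hn t from Units.ext hu]
      exact expUnit_inv_mul_mem_congruence hn hst
    -- If `x` were not nilpotent, its nilpotency class would take the default value `0` and the sum
    -- defining `expEnd` would be empty. An invertible `u` equal to `0` forces `1 = 0`, so `u` is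
    -- trivial; nilpotency of root vectors need not be proved.
    · have h0 : nilpotencyClass (LieModule.toEnd ℂ 𝔤 V x) = 0 := by
        by_contra h0
        exact hn (Nat.nonempty_of_pos_sInf (Nat.pos_of_ne_zero h0))
      have hu0 : (u : LoopEnd V) = 0 := by
        rw [hu, expEnd, h0, Finset.sum_range_zero]
      have h10 : (1 : LoopEnd V) = 0 := by rw [← u.mul_inv, hu0, zero_mul]
      have hu1 : u = 1 := Units.ext (by rw [hu0, Units.val_one, h10])
      exact ⟨1, one_mem _, by rw [hu1, inv_one, one_mul]; exact one_mem _⟩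
  · obtain ⟨s, hs, hst⟩ := exists_convergent_mul_inv_mem (Units.mk0 t ht) N
    refine ⟨torusHom hV hh s, Subgroup.subset_closure (Or.inr ⟨h, hh, s, hs, s.ne_zero,
      (isTorusElement_iff hV hh).2 rfl⟩), ?_⟩
    rw [(isTorusElement_iff hV hh (t := Units.mk0 t ht)).1 hu, ← map_inv, ← map_mul]
    exact torusHom_mem_congruence hV hh hst

theorem chevalley_mono {T T' : Set ℂ⸨X⸩} (h : T ⊆ T') : chevalley H V T ≤ chevalley H V T' := by
  refine Subgroup.closure_mono (Set.union_subset_union ?_ ?_)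
  · rintro u ⟨α, hα, x, hx, t, ht, hu⟩
    exact ⟨α, hα, x, hx, t, h ht, hu⟩
  · rintro u ⟨k, hk, t, ht, ht0, hu⟩
    exact ⟨k, hk, t, h ht, ht0, hu⟩

theorem meroGroup_le_loopGroup : meroGroup H V ≤ loopGroup H V := chevalley_mono (Set.subset_univ _)

theorem holoGroup_le_taylorGroup : holoGroup H V ≤ taylorGroup H V :=
  inf_le_inf_right _ meroGroup_le_loopGroup

/-- A convergent approximant `p` of `k` is automatically holomorphic: `p = k (p⁻¹ k)⁻¹`, and both
factors stabilize `V[[z]]`. -/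
theorem exists_holoGroup_inv_mul_mem (hV : IsWeightModule H V) {k : LoopGL V}
    (hk : k ∈ taylorGroup H V) (N : ℕ) : ∃ p ∈ holoGroup H V, p⁻¹ * k ∈ congruence V N := by
  obtain ⟨p, hp, hpk⟩ := loopGroup_le_adicClosure hV hk.1 N
  have := Subgroup.mul_mem _ hk.2 (Subgroup.inv_mem _ (congruence_le_stabilizer N hpk))
  rw [mul_inv_rev, inv_inv, mul_inv_cancel_left] at this
  exact ⟨p, ⟨hp, this⟩, hpk⟩

/-! ### Flags -/

theorem vcoeff_baseChange (f : V →ₗ[ℂ] V) (n : ℤ) (s : LaurentModule V) :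
    vcoeff n (LinearMap.baseChange ℂ⸨X⸩ f s) = f (vcoeff n s) := by
  induction s using TensorProduct.induction_on with
  | zero => simp
  | tmul a v => simp
  | add x y hx hy => simp only [map_add, hx, hy]

/-- The series `z` as a unit. -/
def zUnit : (ℂ⸨X⸩)ˣ :=
  Units.mk0 zSeries fun h => one_ne_zero (HahnSeries.single_eq_zero_iff.1 h)

theorem vcoeff_torusHom_zUnit (hV : IsWeightModule H V) {h : H}
    (hh : h ∈ dualWeightLattice H V) (n : ℤ) (s : LaurentModule V) :
    vcoeff n ((torusHom hV hh zUnit : LoopEnd V) s) =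
      ∑ μ, weightProj hV μ (vcoeff (n - weightValue hh μ) s) := by
  rw [coe_torusHom, torusEnd, LinearMap.sum_apply, map_sum]
  refine Finset.sum_congr rfl fun μ _ => ?_
  rw [LinearMap.smul_apply, zUnit, Units.val_mk0, zSeries_zpow, vcoeff_single_smul,
    vcoeff_baseChange]

theorem mem_flag_iff (hV : IsWeightModule H V) {h : H} (hh : h ∈ dualWeightLattice H V) (j : ℤ)
    (v : V) : v ∈ flag V h j ↔ ∀ μ, weightValue hh μ < -j → weightProj hV μ v = 0 := by
  have hlie (μ) (w : V) : ⁅(h : 𝔤), weightProj hV μ w⁆ = (weightValue hh μ : ℂ) •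
      weightProj hV μ w := by
    rw [← coe_weightValue hh]
    exact (LieModule.mem_weightSpace _ _).1 (weightProj_mem hV μ w) h
  constructor
  · intro hv μ hμ
    rw [flag, iSup_subtype'] at hv
    induction hv using Submodule.iSup_induction' with
    | mem s v hv =>
      classical
      have h1 : ⁅(h : 𝔤), v⁆ = -((s : ℤ) : ℂ) • v := by
        exact Module.End.mem_eigenspace_iff.1 hv
      have h2 : ⁅(h : 𝔤), v⁆ = ∑ ν, (weightValue hh ν : ℂ) • weightProj hV ν v := by
        conv_lhs => rw [← sum_weightProj hV v, lie_sum]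
        exact Finset.sum_congr rfl fun ν _ => hlie ν v
      have h3 := congrArg (weightProj hV μ) (h1.symm.trans h2)
      rw [map_sum, Finset.sum_eq_single μ] at h3
      · rw [map_smul, map_smul, weightProj_of_mem hV μ (weightProj_mem hV μ v), if_pos rfl,
          ← sub_eq_zero, ← sub_smul] at h3
        refine (smul_eq_zero.1 h3).resolve_left fun h4 => ?_
        have h5 : -(s : ℤ) - weightValue hh μ = 0 := by exact_mod_cast h4
        have := s.2
        omega
      · intro ν _ hν
        rw [map_smul, weightProj_of_mem hV μ (weightProj_mem hV ν v), if_neg hν, smul_zero]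
      · simp
    | zero => exact map_zero _
    | add a b _ _ ha hb => rw [map_add, ha, hb, add_zero]
  · intro hv
    rw [← sum_weightProj hV v]
    refine Submodule.sum_mem _ fun μ _ => ?_
    by_cases hμ : weightValue hh μ < -j
    · rw [hv μ hμ]
      exact zero_mem _
    -- Since `h` acts on `V_s` by `-s`, vectors of weight `μ` have degree `-μ(h)`.
    · refine Submodule.mem_iSup_of_mem (-weightValue hh μ)
        (Submodule.mem_iSup_of_mem (by omega) (Module.End.mem_eigenspace_iff.2 ?_))
      have := hlie μ v
      simpa using this

/-- The operator `z^h` moves the weight `μ` part of the coefficient at `z^j` to `z^(j + μ(h))`.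
Negative powers are therefore absent exactly when no weight with `μ(h) < -j` occurs in that
coefficient, which is the flag condition. -/
theorem mem_flagLattice_iff (hV : IsWeightModule H V) {h : H} (hh : h ∈ dualWeightLattice H V)
    (s : LaurentModule V) :
    s ∈ flagLattice V h ↔ (torusHom hV hh zUnit) • s ∈ taylorLattice V := by
  classical
  have h1 : (torusHom hV hh zUnit) • s ∈ taylorLattice V ↔
      ∀ n < 0, ∀ μ, weightProj hV μ (vcoeff (n - weightValue hh μ) s) = 0 := by
    refine forall₂_congr fun n _ => ?_
    change vcoeff n ((torusHom hV hh zUnit : LoopEnd V) s) = 0 ↔ _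
    rw [vcoeff_torusHom_zUnit]
    constructor
    · intro h0 μ
      have h2 := congrArg (weightProj hV μ) h0
      rw [map_sum, map_zero, Finset.sum_eq_single μ] at h2
      · rwa [weightProj_of_mem hV μ (weightProj_mem hV μ _), if_pos rfl] at h2
      · intro ν _ hν
        rw [weightProj_of_mem hV μ (weightProj_mem hV ν _), if_neg hν]
      · simp
    · intro h0
      exact Finset.sum_eq_zero fun μ _ => h0 μ
  rw [h1, flagLattice, Submodule.mem_iInf]
  simp only [Submodule.mem_comap, mem_flag_iff hV hh]
  constructor
  · intro h2 n hn μ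
    exact h2 _ μ (by omega)
  · intro h2 j μ hμ
    have := h2 (j + weightValue hh μ) (by omega) μ
    rwa [add_sub_cancel_right] at this

theorem flagLattice_eq_smul (hV : IsWeightModule H V) {h : H} (hh : h ∈ dualWeightLattice H V) :
    (flagLattice V h : Set (LaurentModule V)) =
      (torusHom hV hh zUnit)⁻¹ • (taylorLattice V : Set (LaurentModule V)) := by
  ext s
  rw [Set.mem_smul_set_iff_inv_smul_mem, inv_inv]
  exact mem_flagLattice_iff hV hh s

theorem torusHom_zUnit_mem (hV : IsWeightModule H V) {h : H} (hh : h ∈ dualWeightLattice H V) :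
    torusHom hV hh zUnit ∈ meroGroup H V := by
  refine Subgroup.subset_closure (Or.inr ⟨h, hh, zSeries, ?_, zUnit.ne_zero,
    (isTorusElement_iff hV hh).2 rfl⟩)
  refine convergent_of_coeff_eq_zero (N := 2) fun n hn => ?_
  rw [zSeries, HahnSeries.coeff_single_of_ne (by omega)]

/-- Every translate of the flag lattice by `K` is a translate by a germ of a holomorphic
`G`-valued function. -/
theorem exists_holoGroup_smul_flagLattice (hV : IsWeightModule H V) {h : H}
    (hh : h ∈ dualWeightLattice H V) {k : LoopGL V} (hk : k ∈ taylorGroup H V) :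
    ∃ p ∈ holoGroup H V, p • (flagLattice V h : Set (LaurentModule V)) =
      k • (flagLattice V h : Set (LaurentModule V)) := by
  -- With this `M`, the element `z^h (p⁻¹ k) z^(-h)` stabilizes `V[[z]]`, so `p⁻¹ k` stabilizes
  -- `z^(-h) V[[z]]`, the flag lattice.
  obtain ⟨M, hM⟩ := exists_conj_congruence (torusHom hV hh zUnit) 0
  obtain ⟨p, hp, hpk⟩ := exists_holoGroup_inv_mul_mem hV hk M
  refine ⟨p, hp, ?_⟩
  have h1 := congruence_le_stabilizer 0 (hM _ hpk)
  rw [MulAction.mem_stabilizer_iff, mul_smul, mul_smul, ← flagLattice_eq_smul,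
    ← eq_inv_smul_iff, ← flagLattice_eq_smul, mul_smul, inv_smul_eq_iff] at h1
  exact h1.symm

end Density

/-! ### Laurent expansions -/

/-- A formal Laurent series that sums to zero near the origin vanishes. -/
theorem laurentSeries_eq_zero {a : ℂ⸨X⸩}
    (h : ∀ᶠ w in 𝓝[≠] (0 : ℂ), HasSum (fun n : ℤ => w ^ n * a.coeff n) 0) : a = 0 := by
  by_contra ha
  let b : ℕ → ℂ := fun n => a.coeff (a.order + n)
  have hb0 : b 0 ≠ 0 := by
    simpa [b] using (mt HahnSeries.coeff_order_eq_zero.1 ha)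
  have hsum : ∀ᶠ w in 𝓝[≠] (0 : ℂ), HasSum (fun n : ℕ => w ^ n * b n) 0 := by
    filter_upwards [h, self_mem_nhdsWithin] with w hw hw0
    have hw0 : w ≠ 0 := hw0
    have hinj : Function.Injective fun n : ℕ => a.order + (n : ℤ) := fun m n hmn => by
      simpa using hmn
    have h1 := (hinj.hasSum_iff (f := fun n : ℤ => w ^ n * a.coeff n) (a := 0) ?_).2 hw
    · have h2 := h1.mul_left (w ^ (-a.order))
      rw [mul_zero] at h2
      refine h2.congr_fun fun n => ?_
      simp only [Function.comp_apply, b]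
      rw [← mul_assoc, ← zpow_add₀ hw0, neg_add_cancel_left, zpow_natCast]
    · intro n hn
      rw [HahnSeries.coeff_eq_zero_of_lt_order, mul_zero]
      by_contra! hle
      exact hn ⟨(n - a.order).toNat, by simp only; omega⟩
  -- After division by `w ^ a.order` the series is a power series with nonzero constant term `b 0`
  -- and this sum near `0`. Continuity of its sum at `0` gives `b 0 = 0`.
  let f : ℂ → ℂ := fun w => if w = 0 then b 0 else 0
  let p : FormalMultilinearSeries ℂ ℂ ℂ := FormalMultilinearSeries.ofScalars ℂ b
  have hf : HasFPowerSeriesAt f p 0 := by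
    rw [hasFPowerSeriesAt_iff]
    rw [eventually_nhdsWithin_iff] at hsum
    filter_upwards [hsum] with w hw
    rw [zero_add]
    simp only [p, FormalMultilinearSeries.coeff_ofScalars, smul_eq_mul]
    by_cases hw0 : w = 0
    · subst hw0
      simp only [f, if_pos]
      have := hasSum_ite_eq (0 : ℕ) (b 0)
      refine this.congr_fun fun n => ?_
      rcases n with _ | n <;> simp
    · simpa [f, hw0] using hw hw0
  have h1 : Filter.Tendsto f (𝓝[≠] 0) (𝓝 (b 0)) := by
    have := hf.continuousAt.tendsto.mono_left (nhdsWithin_le_nhds (s := {0}ᶜ))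
    simpa [f] using this
  have h2 : Filter.Tendsto f (𝓝[≠] 0) (𝓝 0) := by
    refine tendsto_const_nhds.congr' ?_
    filter_upwards [self_mem_nhdsWithin] with w hw
    exact (if_neg hw).symm
  exact hb0 (tendsto_nhds_unique h1 h2)

section Expansions

variable {S : Type*} [TopologicalSpace S] [ChartedSpace ℂ S]
  {V : Type*} [AddCommGroup V] [Module ℂ V] (c : LocalCoordinates S)

theorem tendsto_chart_symm (x : S) :
    Filter.Tendsto (c.chart x).symm (𝓝[≠] 0) (𝓝[≠] x) := by
  have h0 : (0 : ℂ) ∈ (c.chart x).target := by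
    rw [← c.centered x]
    exact (c.chart x).map_source (c.mem_source x)
  have hx : (c.chart x).symm 0 = x := by
    rw [← c.centered x]
    exact (c.chart x).left_inv (c.mem_source x)
  refine tendsto_nhdsWithin_iff.2 ⟨?_, ?_⟩
  · have := (c.chart x).continuousAt_symm h0
    rw [ContinuousAt, hx] at this
    exact this.mono_left nhdsWithin_le_nhds
  · have h1 := (c.chart x).open_target.mem_nhds h0
    filter_upwards [self_mem_nhdsWithin, mem_nhdsWithin_of_mem_nhds h1] with w hw hwt hwx
    refine hw ?_
    have := (c.chart x).right_inv hwt
    rw [hwx, c.centered x] at this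
    exact this.symm

variable {c}

/-- Laurent expansions are unique. -/
theorem HasLaurentExpansion.unique [FiniteDimensional ℂ V] {f : S → V} {x : S}
    {s t : LaurentModule V} (hs : HasLaurentExpansion c f x s)
    (ht : HasLaurentExpansion c f x t) : s = t := by
  refine ext_vcoeff fun n => ?_
  rw [← sub_eq_zero, ← Module.forall_dual_apply_eq_zero_iff ℂ]
  intro φ
  rw [map_sub, sub_eq_zero]
  have h : component φ s - component φ t = 0 := by
    refine laurentSeries_eq_zero ?_
    have hev := (tendsto_chart_symm c x).eventually (hs.and ht)
    have h0 : (0 : ℂ) ∈ (c.chart x).target := by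
      rw [← c.centered x]
      exact (c.chart x).map_source (c.mem_source x)
    have h1 := (c.chart x).open_target.mem_nhds h0
    filter_upwards [hev, mem_nhdsWithin_of_mem_nhds h1] with w hw hwt
    have h2 := (hw.1 φ).sub (hw.2 φ)
    rw [sub_self, (c.chart x).right_inv hwt] at h2
    refine h2.congr_fun fun m => ?_
    rw [HahnSeries.coeff_sub, coeff_component, coeff_component, mul_sub]
  have h' := congrArg (fun a => HahnSeries.coeff a n) (sub_eq_zero.1 h)
  simpa only [coeff_component] using h'

theorem sub_mem_filtration {N : ℤ} {s t : LaurentModule V} (hs : s ∈ filtration V N)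
    (ht : t ∈ filtration V N) : s - t ∈ filtration V N := fun n hn => by
  rw [map_sub, hs n hn, ht n hn, sub_zero]

/-- A Laurent polynomial with vector coefficients. -/
def laurentPolynomial (I : Finset ℤ) (v : ℤ → V) : LaurentModule V :=
  ∑ n ∈ I, (HahnSeries.single n (1 : ℂ) : ℂ⸨X⸩) ⊗ₜ[ℂ] v n

theorem vcoeff_laurentPolynomial (I : Finset ℤ) (v : ℤ → V) (m : ℤ) :
    vcoeff m (laurentPolynomial I v) = if m ∈ I then v m else 0 := by
  rw [laurentPolynomial, map_sum]
  simp only [vcoeff_tmul, HahnSeries.coeff_single, ite_smul, one_smul, zero_smul]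
  rw [Finset.sum_ite_eq]

theorem hasLaurentExpansion_laurentPolynomial (c : LocalCoordinates S) (x : S) (I : Finset ℤ)
    (v : ℤ → V) : HasLaurentExpansion c (fun y => ∑ n ∈ I, c.chart x y ^ n • v n) x
      (laurentPolynomial I v) := by
  refine Filter.Eventually.of_forall fun y φ => ?_
  rw [map_sum]
  have h := hasSum_sum_of_ne_finset_zero (L := .unconditional ℤ) (s := I)
    (f := fun n : ℤ => c.chart x y ^ n * φ (vcoeff n (laurentPolynomial I v))) fun n hn => by
      rw [vcoeff_laurentPolynomial, if_neg hn, map_zero, mul_zero]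
  convert! h using 1
  refine Finset.sum_congr rfl fun n hn => ?_
  rw [vcoeff_laurentPolynomial, if_pos hn, map_smul, smul_eq_mul]

theorem exists_laurentPolynomial (s : LaurentModule V) (N : ℤ) :
    ∃ (I : Finset ℤ) (v : ℤ → V), s - laurentPolynomial I v ∈ filtration V N := by
  obtain ⟨M, hM⟩ := exists_mem_filtration s
  refine ⟨Finset.Ico M N, fun n => vcoeff n s, fun n hn => ?_⟩
  rw [map_sub, vcoeff_laurentPolynomial]
  split_ifs with h
  · rw [sub_self]
  · rw [Finset.mem_Ico] at h
    rw [hM n (by omega), sub_zero]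

/-- The translate contains all series of high order because `g⁻¹` lowers orders by a bounded amount.
-/
theorem exists_filtration_le_smul [FiniteDimensional ℂ V] (g : LoopGL V) :
    ∃ N : ℤ, ∀ s ∈ filtration V N, s ∈ g • (taylorLattice V : Set (LaurentModule V)) := by
  obtain ⟨p, hp⟩ := exists_shiftsBy ((g⁻¹ : LoopGL V) : LoopEnd V)
  refine ⟨-p, fun s hs => ?_⟩
  rw [Set.mem_smul_set_iff_inv_smul_mem]
  have := hp _ s hs
  rwa [neg_add_cancel] at this

variable [IsManifold 𝓘(ℂ) ω S] [T1Space S]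

/-- Laurent polynomials in the local coordinate at a point of `Γ` are sections near that point. -/
theorem exists_isLocalSection (c : LocalCoordinates S) (Γ : Finset S) (γ : Γ) (I : Finset ℤ)
    (v : ℤ → V) : ∃ (U : TopologicalSpace.Opens S) (f : S → V), (γ : S) ∈ U ∧
      HasLaurentExpansion c f γ (laurentPolynomial I v) ∧
      ∀ L : Γ → Set (LaurentModule V), laurentPolynomial I v ∈ L γ → IsLocalSection c Γ L U f := by
  -- The other points of `Γ` are removed so that the section condition concerns `γ` alone.
  have hopen : IsOpen ((c.chart γ).source \ ((Γ : Set S) \ {(γ : S)})) :=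
    (c.chart γ).open_source.sdiff (Γ.finite_toSet.subset Set.sdiff_subset).isClosed
  let f : S → V := fun y => ∑ n ∈ I, c.chart γ y ^ n • v n
  have hf := hasLaurentExpansion_laurentPolynomial c (γ : S) I v
  refine ⟨⟨_, hopen⟩, f, ⟨c.mem_source γ, fun h => h.2 rfl⟩, hf, fun L hL => ⟨fun φ => ?_, ?_⟩⟩
  · have hchart : ∀ y ∈ (c.chart γ).source, MDifferentiableAt 𝓘(ℂ) 𝓘(ℂ) (c.chart γ) y :=
      fun y hy => ((contMDiffOn_of_mem_maximalAtlas (c.mem_atlas γ)).contMDiffAt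
        ((c.chart γ).open_source.mem_nhds hy)).mdifferentiableAt (by simp)
    rintro y ⟨⟨hy, -⟩, hyΓ⟩
    -- Negative powers of the coordinate are differentiable off its only zero in the chart, `γ`.
    have hy0 : c.chart γ y ≠ 0 := fun h0 => hyΓ <| by
      rw [(c.chart γ).injOn hy (c.mem_source γ) (h0.trans (c.centered γ).symm)]
      exact γ.2
    have hd : DifferentiableAt ℂ (fun w : ℂ => ∑ n ∈ I, w ^ n * φ (v n)) (c.chart γ y) :=
      DifferentiableAt.fun_sum fun n _ => (differentiableAt_zpow.2 (Or.inl hy0)).mul_const _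
    have h1 := hd.mdifferentiableAt.comp y (hchart y hy)
    refine MDifferentiableAt.mdifferentiableWithinAt (h1.congr_of_eventuallyEq ?_)
    refine Filter.Eventually.of_forall fun w => ?_
    simp [f]
  · rintro δ ⟨-, hδ⟩
    have : δ = γ := by
      by_contra hne
      exact hδ ⟨δ.2, fun h => hne (Subtype.ext h)⟩
    subst this
    exact ⟨_, hL, hf⟩

/-- The sections determine the lattices. -/
theorem smul_taylorLattice_subset_of_isLocalSection [FiniteDimensional ℂ V]
    (c : LocalCoordinates S) (Γ : Finset S) (a a' : Γ → LoopGL V)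
    (h : ∀ U f, IsLocalSection c Γ (fun γ => a γ • (taylorLattice V : Set (LaurentModule V))) U f →
      IsLocalSection c Γ (fun γ => a' γ • (taylorLattice V : Set (LaurentModule V))) U f) (γ : Γ) :
    a γ • (taylorLattice V : Set (LaurentModule V)) ⊆
      a' γ • (taylorLattice V : Set (LaurentModule V)) := by
  intro s hs
  obtain ⟨N, hN⟩ := exists_filtration_le_smul (a γ)
  obtain ⟨N', hN'⟩ := exists_filtration_le_smul (a' γ)
  -- The series `s` may diverge, so it cannot be used as a section. It differs from a Laurent
  -- polynomial by a tail lying in both lattices, so membership may be tested on the polynomial.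
  obtain ⟨I, v, hIv⟩ := exists_laurentPolynomial s (max N N')
  have h1 := hN _ (filtration_anti (le_max_left N N') hIv)
  have h2 := hN' _ (filtration_anti (le_max_right N N') hIv)
  rw [Set.mem_smul_set_iff_inv_smul_mem] at hs h1 h2 ⊢
  rw [smul_sub] at h1 h2
  have h3 : laurentPolynomial I v ∈ a γ • (taylorLattice V : Set (LaurentModule V)) := by
    rw [Set.mem_smul_set_iff_inv_smul_mem]
    have := sub_mem_filtration (N := 0) hs h1
    rwa [sub_sub_cancel] at this
  obtain ⟨U, f, hγU, hf, hsec⟩ := exists_isLocalSection c Γ γ I v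
  obtain ⟨t, ht, hft⟩ := (h U f (hsec _ h3)).2 γ hγU
  rw [← hf.unique hft, Set.mem_smul_set_iff_inv_smul_mem] at ht
  have := (taylorLattice V).add_mem h2 ht
  rwa [sub_add_cancel] at this

end Expansions

/-! ### Constant loops -/

section Constants

variable {𝔤 : Type*} [LieRing 𝔤] [LieAlgebra ℂ 𝔤] [FiniteDimensional ℂ 𝔤]
  [LieAlgebra.IsSemisimple ℂ 𝔤]
  {H : LieSubalgebra ℂ 𝔤} [H.IsCartanSubalgebra]
  {V : Type*} [AddCommGroup V] [Module ℂ V] [LieRingModule 𝔤 V] [LieModule ℂ 𝔤 V]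
  [FiniteDimensional ℂ V]

theorem vcoeff_constGL_smul (g : LinearMap.GeneralLinearGroup ℂ V) (n : ℤ) (s : LaurentModule V) :
    vcoeff n (constGL V g • s) = g • vcoeff n s :=
  vcoeff_baseChange (g : Module.End ℂ V) n s

theorem constGL_mem_stabilizer (g : LinearMap.GeneralLinearGroup ℂ V) :
    constGL V g ∈
      MulAction.stabilizer (LoopGL V) (taylorLattice V : Set (LaurentModule V)) := by
  have key (g : LinearMap.GeneralLinearGroup ℂ V) (s : LaurentModule V)
      (hs : s ∈ taylorLattice V) : constGL V g • s ∈ taylorLattice V := fun n hn => by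
    rw [vcoeff_constGL_smul, hs n hn, smul_zero]
  exact mem_stabilizer_iff.2 ⟨key g, by rw [← map_inv]; exact key g⁻¹⟩

theorem constGL_mem_taylorGroup {g : LinearMap.GeneralLinearGroup ℂ V} (hg : g ∈ constGroup H V) :
    constGL V g ∈ taylorGroup H V :=
  ⟨chevalley_mono (Set.subset_univ _) hg, constGL_mem_stabilizer g⟩

variable {S : Type*} [TopologicalSpace S] [ChartedSpace ℂ S] {c : LocalCoordinates S}

theorem HasLaurentExpansion.const_smul {f : S → V} {x : S} {s : LaurentModule V}
    (hs : HasLaurentExpansion c f x s) (g : LinearMap.GeneralLinearGroup ℂ V) :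
    HasLaurentExpansion c (fun y => g • f y) x (constGL V g • s) := by
  filter_upwards [hs] with y hy φ
  have := hy (φ ∘ₗ (g : Module.End ℂ V))
  simp only [vcoeff_constGL_smul]
  exact this

theorem IsLocalSection.const_smul {Γ : Finset S} {L : Γ → Set (LaurentModule V)}
    {U : TopologicalSpace.Opens S} {f : S → V} (hf : IsLocalSection c Γ L U f)
    (g : LinearMap.GeneralLinearGroup ℂ V) :
    IsLocalSection c Γ (fun γ => constGL V g • L γ) U fun y => g • f y := by
  refine ⟨fun φ => hf.1 (φ ∘ₗ (g : Module.End ℂ V)), fun γ hγ => ?_⟩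
  obtain ⟨s, hs, hfs⟩ := hf.2 γ hγ
  exact ⟨_, Set.smul_mem_smul_set hs, hfs.const_smul g⟩

theorem isLocalSection_const_smul_iff {Γ : Finset S} {L : Γ → Set (LaurentModule V)}
    {U : TopologicalSpace.Opens S} {f : S → V} (g : LinearMap.GeneralLinearGroup ℂ V) :
    IsLocalSection c Γ (fun γ => constGL V g • L γ) U (fun y => g • f y) ↔
      IsLocalSection c Γ L U f := by
  refine ⟨fun h => ?_, fun h => h.const_smul g⟩
  simpa only [map_inv, inv_smul_smul] using h.const_smul g⁻¹

end Constants

/-! ### The moduli space as a space of lattices -/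

section Moduli

variable {𝔤 : Type*} [LieRing 𝔤] [LieAlgebra ℂ 𝔤] [FiniteDimensional ℂ 𝔤]
  [LieAlgebra.IsSemisimple ℂ 𝔤]
  {H : LieSubalgebra ℂ 𝔤} [H.IsCartanSubalgebra]
  {V : Type*} [AddCommGroup V] [Module ℂ V] [LieRingModule 𝔤 V] [LieModule ℂ 𝔤 V]
  [FiniteDimensional ℂ V]
  {S : Type*} {Γ : Finset S}

theorem GermDistribution.stalk_eq_smul (Ψ : GermDistribution H V Γ) :
    Ψ.stalk = fun γ : Γ => (Ψ.germ γ)⁻¹ • (taylorLattice V : Set (LaurentModule V)) := by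
  funext γ
  ext s
  rw [Set.mem_smul_set_iff_inv_smul_mem, inv_inv]
  rfl

variable (V) in
/-- The family of the lattices determined by the flags of `h`. -/
def flagLattices (h : Γ → H) : Γ → Set (LaurentModule V) := fun γ => flagLattice V (h γ)

/-- The product acts componentwise, and elements of `K` already lie in `G(ℂ((z)))`, so stabilizing
the flag lattice is the only condition at each `γ`. -/
theorem K₀_eq_stabilizer (h : Γ → H) :
    K₀ V h = MulAction.stabilizer (Γ → taylorGroup H V) (flagLattices V h) := by
  ext k
  rw [K₀, Subgroup.mem_pi, MulAction.mem_stabilizer_iff, funext_iff]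
  refine forall_congr' fun γ => ?_
  simp only [Set.mem_univ, forall_const]
  exact ⟨fun hk => hk.2, fun hk => ⟨(k γ).2.1, hk⟩⟩

variable [TopologicalSpace S] [ChartedSpace ℂ S] [T1Space S] [IsManifold 𝓘(ℂ) ω S]
  {c : LocalCoordinates S} {h : Γ → H}

theorem MatrixDivisor.exists_stalk_eq_smul (D : MatrixDivisor H V Γ) :
    ∃ a : Γ → LoopGL V,
      D.stalk = fun γ => a γ • (taylorLattice V : Set (LaurentModule V)) := by
  induction D using Quotient.inductionOn with
  | h Ψ => exact ⟨_, Ψ.stalk_eq_smul⟩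

theorem MatrixDivisor.stalk_eq_of_isSection_iff {D D' : MatrixDivisor H V Γ}
    (hD : ∀ U f, D.IsSection c U f ↔ D'.IsSection c U f) : D.stalk = D'.stalk := by
  obtain ⟨a, ha⟩ := D.exists_stalk_eq_smul
  obtain ⟨a', ha'⟩ := D'.exists_stalk_eq_smul
  simp only [MatrixDivisor.IsSection, ha, ha'] at hD
  rw [ha, ha']
  exact funext fun γ => Set.Subset.antisymm
    (smul_taylorLattice_subset_of_isLocalSection c Γ a a' (fun U f => (hD U f).1) γ)
    (smul_taylorLattice_subset_of_isLocalSection c Γ a' a (fun U f => (hD U f).2) γ)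

/-- The stalks at the points of `Γ` of the sheaf of sections of a point of the moduli space. -/
def ModuliSpace.stalk (m : ModuliSpace V c h) : Γ → Set (LaurentModule V) :=
  Quotient.lift (fun D : {D : MatrixDivisor H V Γ // D.HasInvariants h} => D.1.stalk)
    (fun _ _ hD => MatrixDivisor.stalk_eq_of_isSection_iff hD) m

theorem ModuliSpace.isSection_iff (m : ModuliSpace V c h) (U : TopologicalSpace.Opens S)
    (f : S → V) : m.IsSection U f ↔ IsLocalSection c Γ m.stalk U f := by
  induction m using Quotient.inductionOn with
  | h D => exact Iff.rfl

theorem ModuliSpace.stalk_injective :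
    Function.Injective (ModuliSpace.stalk (V := V) (c := c) (h := h)) := by
  intro m m'
  induction m using Quotient.inductionOn with | h D => ?_
  induction m' using Quotient.inductionOn with | h D' => ?_
  intro hD
  have hD : D.1.stalk = D'.1.stalk := hD
  exact Quotient.sound fun U f => by simp only [MatrixDivisor.IsSection, hD]

theorem ModuliSpace.exists_stalk_eq_smul (m : ModuliSpace V c h) :
    ∃ a : Γ → LoopGL V,
      m.stalk = fun γ => a γ • (taylorLattice V : Set (LaurentModule V)) := by
  induction m using Quotient.inductionOn with
  | h D => exact D.1.exists_stalk_eq_smul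

theorem GermDistribution.stalk_toModuli (Ψ : GermDistribution H V Γ) (hΨ : Ψ.HasInvariants h) :
    (Ψ.toModuli c hΨ).stalk =
      fun γ : Γ => (Ψ.germ γ)⁻¹ • (taylorLattice V : Set (LaurentModule V)) :=
  Ψ.stalk_eq_smul

theorem ModuliSpace.stalk_mem_orbit (hV : IsWeightModule H V)
    (hh : ∀ γ, h γ ∈ dualWeightLattice H V) (m : ModuliSpace V c h) :
    m.stalk ∈ MulAction.orbit (Γ → taylorGroup H V) (flagLattices V h) := by
  induction m using Quotient.inductionOn with | h D => ?_
  obtain ⟨D, hD⟩ := D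
  induction D using Quotient.inductionOn with | h Ψ => ?_
  have hΨ : Ψ.HasInvariants h := hD
  choose k hk k' hk' u hu hΨu using hΨ
  -- If `Ψ_γ = k z^h k'`, then `Ψ_γ⁻¹ V[[z]] = k'⁻¹ z^(-h) k⁻¹ V[[z]] = k'⁻¹ F_h`.
  refine ⟨fun γ => ⟨k' γ, holoGroup_le_taylorGroup (hk' γ)⟩⁻¹, ?_⟩
  refine Eq.trans ?_ Ψ.stalk_eq_smul.symm
  funext γ
  have h1 := (Subgroup.inv_mem _ (hk γ)).2
  have h2 : (k γ)⁻¹ • (taylorLattice V : Set (LaurentModule V)) = taylorLattice V := h1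
  rw [hΨu, mul_inv_rev, mul_inv_rev, mul_smul, mul_smul, h2,
    (isTorusElement_iff hV (hh γ) (t := zUnit)).1 (hu γ), ← flagLattice_eq_smul]
  rfl

/-- Surjectivity onto the orbit: after `k` is replaced by a convergent `p` with the same translate
of the flag lattice, the germs `z^h p⁻¹` on `Γ` and `1` elsewhere form a distribution. -/
theorem exists_moduli_stalk_eq (hV : IsWeightModule H V)
    (hh : ∀ γ, h γ ∈ dualWeightLattice H V) (k : Γ → taylorGroup H V) :
    ∃ m : ModuliSpace V c h, m.stalk = k • flagLattices V h := by
  classical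
  choose p hp hpk using fun γ => exists_holoGroup_smul_flagLattice hV (hh γ) (k γ).2
  let Ψ : GermDistribution H V Γ :=
    { germ := fun x => if hx : x ∈ Γ then torusHom hV (hh ⟨x, hx⟩) zUnit * (p ⟨x, hx⟩)⁻¹ else 1
      mem_mero := fun x => by
        split_ifs with hx
        · exact mul_mem (torusHom_zUnit_mem hV _) (inv_mem (hp ⟨x, hx⟩).1)
        · exact one_mem _
      mem_holo := fun x hx => by
        rw [dif_neg hx]
        exact one_mem _ }
  have hΨγ (γ : Γ) : Ψ.germ γ = torusHom hV (hh γ) zUnit * (p γ)⁻¹ := dif_pos γ.2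
  have hΨ : Ψ.HasInvariants h := fun γ => ⟨1, one_mem _, (p γ)⁻¹, inv_mem (hp γ),
    torusHom hV (hh γ) zUnit, (isTorusElement_iff hV (hh γ) (t := zUnit)).2 rfl,
    by rw [hΨγ, one_mul]⟩
  refine ⟨Ψ.toModuli c hΨ, ?_⟩
  rw [Ψ.stalk_toModuli]
  funext γ
  rw [hΨγ, mul_inv_rev, inv_inv, mul_smul, ← flagLattice_eq_smul, hpk]
  rfl

/-- The moduli space is the orbit of the family of lattices determined by the flags of `h`. -/
def moduliEquivOrbit (c : LocalCoordinates S) (hV : IsWeightModule H V)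
    (hh : ∀ γ, h γ ∈ dualWeightLattice H V) :
    ModuliSpace V c h ≃ MulAction.orbit (Γ → taylorGroup H V) (flagLattices V h) :=
  Equiv.ofBijective (fun m => ⟨m.stalk, m.stalk_mem_orbit hV hh⟩)
    ⟨fun _ _ e => ModuliSpace.stalk_injective (congrArg Subtype.val e), by
      rintro ⟨_, k, rfl⟩
      obtain ⟨m, hm⟩ := exists_moduli_stalk_eq hV hh k
      exact ⟨m, Subtype.ext hm⟩⟩

theorem stalk_moduliEquivOrbit_symm (hV : IsWeightModule H V)
    (hh : ∀ γ, h γ ∈ dualWeightLattice H V)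
    (x : MulAction.orbit (Γ → taylorGroup H V) (flagLattices V h)) :
    ((moduliEquivOrbit c hV hh).symm x).stalk = x :=
  congrArg Subtype.val ((moduliEquivOrbit c hV hh).apply_symm_apply x)

theorem ModuliSpace.isShift_iff {g : LinearMap.GeneralLinearGroup ℂ V} {m m' : ModuliSpace V c h} :
    ModuliSpace.IsShift g m m' ↔ ∀ γ, constGL V g • m.stalk γ = m'.stalk γ := by
  have hsec : ModuliSpace.IsShift g m m' ↔
      ∀ U f, IsLocalSection c Γ (fun γ => constGL V g • m.stalk γ) U f ↔
        IsLocalSection c Γ m'.stalk U f := by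
    refine forall_congr' fun U => ?_
    constructor
    · intro hs f
      -- Every function is the shift by `g` of its shift by `g⁻¹`.
      have := hs fun y => g⁻¹ • f y
      rw [m.isSection_iff, m'.isSection_iff, ← isLocalSection_const_smul_iff g] at this
      simpa only [smul_inv_smul] using this
    · intro hs f
      rw [m.isSection_iff, m'.isSection_iff, ← isLocalSection_const_smul_iff g]
      exact hs _
  rw [hsec]
  constructor
  · obtain ⟨a, ha⟩ := m.exists_stalk_eq_smul
    obtain ⟨a', ha'⟩ := m'.exists_stalk_eq_smul
    simp only [ha, ha', ← mul_smul]
    intro hs γ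
    exact Set.Subset.antisymm
      (smul_taylorLattice_subset_of_isLocalSection c Γ _ a' (fun U f => (hs U f).1) γ)
      (smul_taylorLattice_subset_of_isLocalSection c Γ a' _ (fun U f => (hs U f).2) γ)
  · intro hs U f
    simp only [hs]

end Moduli

end MatrixDivisors

end

/-! ### The moduli space as a homogeneous space -/

open scoped Manifold ContDiff Pointwise in
open MatrixDivisors in
theorem mainTheorem3
    {𝔤 : Type*} [LieRing 𝔤] [LieAlgebra ℂ 𝔤] [FiniteDimensional ℂ 𝔤] [LieAlgebra.IsSemisimple ℂ 𝔤]
    (H : LieSubalgebra ℂ 𝔤) [H.IsCartanSubalgebra]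
    (b : (LieAlgebra.IsKilling.rootSystem H).Base)
    (V : Type*) [AddCommGroup V] [Module ℂ V] [LieRingModule 𝔤 V] [LieModule ℂ 𝔤 V]
    [FiniteDimensional ℂ V] [LieModule.IsIrreducible ℂ 𝔤 V] [LieModule.IsFaithful ℂ 𝔤 V]
    (χ : Module.Dual ℂ H) (_hχ : IsHighestWeight V b χ)
    {S : Type*} [TopologicalSpace S] [T2Space S] [ConnectedSpace S] [ChartedSpace ℂ S]
    [IsManifold 𝓘(ℂ) ω S] (c : LocalCoordinates S)
    (Γ : Finset S) (h : Γ → H) (_hh : ∀ γ, h γ ∈ dominantChamber V b) :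
    ∃ (_ : MulAction (Γ → taylorGroup H V) (ModuliSpace V c h))
      (e : ((Γ → taylorGroup H V) ⧸ K₀ V h) ≃ ModuliSpace V c h),
      -- the action is `(k, Ψ) ↦ Ψ k⁻¹`, up to left multiplication by elements of `K`
      (∀ (k : Γ → taylorGroup H V) (Ψ Ψ' : GermDistribution H V Γ)
          (hΨ : Ψ.HasInvariants h) (hΨ' : Ψ'.HasInvariants h),
        k • Ψ.toModuli c hΨ = Ψ'.toModuli c hΨ' ↔
          ∀ γ : Γ, Ψ'.germ γ * (k γ : LoopGL V) * (Ψ.germ γ)⁻¹ ∈ taylorGroup H V) ∧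
      -- `e` is an isomorphism of sets with an action of `∏ K`
      (∀ (k : Γ → taylorGroup H V) (x : (Γ → taylorGroup H V) ⧸ K₀ V h), e (k • x) = k • e x) ∧
      -- `e` sends the coset of `k` to the divisor whose flag at `γ` is the image under `k γ` of the
      -- flag determined by `h γ`
      (∀ (k : Γ → taylorGroup H V) (U : TopologicalSpace.Opens S) (f : S → V),
        (e (QuotientGroup.mk k)).IsSection U f ↔
          IsLocalSection c Γ
            (fun γ => (k γ : LoopGL V) • (flagLattice V (h γ) : Set (LaurentModule V))) U f) ∧
      -- shifts of sheaves of sections by constants correspond to the diagonal action of `G(ℂ)`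
      (∀ g ∈ constGroup H V, ∀ m m' : ModuliSpace V c h,
        ModuliSpace.IsShift g m m' ↔
          ∃ κ : taylorGroup H V, (κ : LoopGL V) = constGL V g ∧
            (fun _ : Γ => κ) • m = m') := by
  obtain ⟨v, hv, hv0, -⟩ := _hχ
  have hV : IsWeightModule H V := iSup_weightSpace_eq_top hv hv0
  have hh : ∀ γ, h γ ∈ dualWeightLattice H V := fun γ => (_hh γ).1
  let ψ := moduliEquivOrbit c hV hh
  -- A formal `Ψ k⁻¹` need not converge, so the action is defined on lattices and transported along
  -- `ψ`.
  let act : MulAction (Γ → taylorGroup H V) (ModuliSpace V c h) := ψ.mulAction _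
  have hact (k : Γ → taylorGroup H V) (m : ModuliSpace V c h) : (k • m).stalk = k • m.stalk :=
    stalk_moduliEquivOrbit_symm hV hh _
  let e : ((Γ → taylorGroup H V) ⧸ K₀ V h) ≃ ModuliSpace V c h :=
    ((Subgroup.quotientEquivOfEq (K₀_eq_stabilizer h)).trans
      (MulAction.orbitEquivQuotientStabilizer _ (flagLattices V h)).symm).trans ψ.symm
  have he (k : Γ → taylorGroup H V) :
      (e (QuotientGroup.mk k)).stalk = k • flagLattices V h :=
    stalk_moduliEquivOrbit_symm hV hh _
  refine ⟨act, e, fun k Ψ Ψ' hΨ hΨ' => ?_, fun k x => ?_, fun k U f => ?_,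
    fun g hg m m' => ?_⟩
  · rw [← ModuliSpace.stalk_injective.eq_iff, hact, Ψ.stalk_toModuli, Ψ'.stalk_toModuli,
      funext_iff]
    refine forall_congr' fun γ => ?_
    -- Equality of the lattices `k Ψ⁻¹ V[[z]]` and `Ψ'⁻¹ V[[z]]` says that `Ψ' k Ψ⁻¹` stabilizes
    -- `V[[z]]`; as this product lies in the loop group, that amounts to membership in `K`.
    have hmem : Ψ'.germ γ * (k γ : LoopGL V) * (Ψ.germ γ)⁻¹ ∈ loopGroup H V :=
      mul_mem (mul_mem (meroGroup_le_loopGroup (Ψ'.mem_mero γ)) (k γ).2.1)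
        (inv_mem (meroGroup_le_loopGroup (Ψ.mem_mero γ)))
    have hstab : Ψ'.germ γ * (k γ : LoopGL V) * (Ψ.germ γ)⁻¹ ∈ taylorGroup H V ↔
        (Ψ'.germ γ * (k γ : LoopGL V) * (Ψ.germ γ)⁻¹) •
          (taylorLattice V : Set (LaurentModule V)) = taylorLattice V := and_iff_right hmem
    rw [hstab, mul_smul, mul_smul, ← eq_inv_smul_iff]
    exact Iff.rfl
  · induction x using QuotientGroup.induction_on with | H k' => ?_
    refine ModuliSpace.stalk_injective ?_
    rw [hact, he, ← mul_smul]
    exact he (k * k')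
  · rw [ModuliSpace.isSection_iff, he]
    exact Iff.rfl
  · rw [ModuliSpace.isShift_iff, ← funext_iff]
    constructor
    · intro hs
      refine ⟨⟨_, constGL_mem_taylorGroup hg⟩, rfl, ModuliSpace.stalk_injective ?_⟩
      rw [hact]
      exact hs
    · rintro ⟨κ, hκ, rfl⟩
      rw [hact, ← hκ]
      rfl
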